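/- Let $K$ be a field of characteristic different from $2$ and $3$, with algebraic closure $\overline K$. For $\phi,\psi\in K(z)$ and a field $L\in\{K,\overline K\}$, say that $\phi$ and $\psi$ are \emph{conjugate over $L$} if $\psi=h^{-1}\circ\phi\circ h$ for some $h\in \mathrm{PGL}_2(L)$. The multiplier of a rational map $\phi$ at a finite fixed point $P$ is $\phi'(P)$, and its multiplier at a fixed point at $\infty$ is that of $1/\phi(1/z)$ at $0$. Let $\psi(z)\in K(z)$ have degree $2$, and let $\lambda_1,\lambda_2,\lambda_3\in\overline K$ be the multipliers of its fixed points in $\mathbb P^1(\overline K)$, counted with multiplicity and listed in any order. (a) If the multipliers are distinct, or if exactly two of them equal $1$, then $\sigma_1=\lambda_1+\lambda_2+\lambda_3$ and $\sigma_2=\lambda_1\lambda_2+\lambda_1\lambda_3+\lambda_2\lambda_3$ lie in $K$, and $\psi$ is conjugate over $K$ to $$\phi_{\sigma_1,\sigma_2}(z)=\frac{2z^2+(2-\sigma_1)z+(2-\sigma_1)}{-z^2+(2+\sigma_1)z+2-\sigma_1-\sigma_2}.$$ Furthermore, if $\sigma_1,\sigma_2,\sigma_1',\sigma_2'\in K$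 are such that $\phi_{\sigma_1,\sigma_2}$ and $\phi_{\sigma_1',\sigma_2'}$ have degree $2$ and are conjugate over $\overline K$, then $\sigma_1=\sigma_1'$ and $\sigma_2=\sigma_2'$. (b) If $\lambda_1=\lambda_2\neq 1$ and $\lambda_3\ne\lambda_1$, or if $\lambda_1=\lambda_2=\lambda_3=1$, then $k=\frac{\lambda_1+1}{2}$ lies in $K\smallsetminus\{0,-\tfrac12\}$, and $\psi$ is conjugate over $K$ to $\phi_{k,b}(z)=kz+\frac bz$ for some $b\in K^*$. Furthermore, for $k,k'\in K\smallsetminus\{0,-\tfrac12\}$ and $b,b'\in K^*$, the maps $\phi_{k,b}$ and $\phi_{k',b'}$ (which have degree $2$) are conjugate over $\overline K$ if and only if $k=k'$, and they are conjugate over $K$ if and only if $k=k'$ and $b/b'\in(K^*)^2$. (c) If $\lambda_1=\lambda_2=\lambda_3=-2$, then $\psi$ is conjugate over $K$ to a map of the form $$\theta_{d,k}(z)=\frac{kz^2-2dz+dk}{z^2-2kz+d},\qquad k\in K,\ d\in K^*,\ k^2\ne d.$$ All such maps have degree $2$ and are conjugate to each other over $\overline K$. Furthermore, two such maps $\theta_{d,k}$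 and $\theta_{d',k'}$ are conjugate over $K$ if and only if there are $b\in K^*$ and $\gamma\in K$ such that $d'=b^2d$ and $k'$ equals one of $$\frac{bd}{k},\qquad \frac{b\,(d^2\gamma^3+3dk\gamma^2+3d\gamma+k)}{dk\gamma^3+3d\gamma^2+3k\gamma+1}$$ (with the denominator of the expression in question nonzero). Every degree-$2$ map in $K(z)$ falls, up to reordering its multipliers, into exactly one of the cases (a), (b), (c). Moreover these lists give a complete description of the $K$-conjugacy classes: a degree-$2$ map in $K(z)$ is in case (a) (respectively (b), (c)) if and only if it is conjugate over $K$ to some $\phi_{\sigma_1,\sigma_2}$ with $\sigma_1,\sigma_2\in K$ (respectively some $\phi_{k,b}$ with $k\in K\smallsetminus\{0,-\frac12\}$, $b\in K^*$; some $\theta_{d,k}$ with $k\in K$, $d\in K^*$, $k^2\neq d$). -/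

import Mathlib

noncomputable section

namespace QuadraticMaps

open Polynomial

variable {F : Type*} [Field F]

/-- The degree of a rational map `φ = P / Q` in lowest terms: `max (deg P) (deg Q)`. -/
def ratDegree (φ : RatFunc F) : ℕ := max φ.num.natDegree φ.denom.natDegree

/-- Composition `φ ∘ g` in `F(z)`, by substituting `g` for the variable of `φ`. -/
def ratComp (φ g : RatFunc F) : RatFunc F := φ.eval RatFunc.C g

/-- The Möbius map `z ↦ (a z + b) / (c z + d)` of an invertible matrix with rows `(a, b)`
and `(c, d)`. -/
def mobius (h : GL (Fin 2) F) : RatFunc F :=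
  (RatFunc.C (h 0 0) * RatFunc.X + RatFunc.C (h 0 1)) /
    (RatFunc.C (h 1 0) * RatFunc.X + RatFunc.C (h 1 1))

/-- `φ^h = h⁻¹ ∘ φ ∘ h`. -/
def conjBy (h : GL (Fin 2) F) (φ : RatFunc F) : RatFunc F :=
  ratComp (mobius h⁻¹) (ratComp φ (mobius h))

/-- Conjugacy of rational maps over their field of coefficients. Scalar matrices act trivially, so
ranging over `GL₂` is the same as ranging over `PGL₂`. -/
def IsConj (φ ψ : RatFunc F) : Prop := ∃ h : GL (Fin 2) F, conjBy h φ = ψ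

/-- The derivative `φ'(x) = (P' Q - P Q')(x) / Q(x)²` at a finite point `x` that is not a pole. -/
def derivAt (φ : RatFunc F) (x : F) : F :=
  (derivative φ.num * φ.denom - φ.num * derivative φ.denom).eval x / (φ.denom.eval x) ^ 2

/-- `P(z) - z Q(z)`, whose roots are the finite fixed points of `φ = P / Q`. -/
def fixedPoly (φ : RatFunc F) : F[X] := φ.num - X * φ.denom

/-- The conjugate `1 / φ(1 / z)` of `φ`, which moves the point at infinity to `0`. -/
def atInfty (φ : RatFunc F) : RatFunc F := (ratComp φ (RatFunc.X)⁻¹)⁻¹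

/-- The multipliers of the fixed points of `φ` on the projective line over `F`, each repeated
according to the multiplicity of the fixed point. The point at infinity is treated through the
conjugate `1 / φ(1 / z)` at `0`. -/
def multipliers (φ : RatFunc F) : Multiset F :=
  (fixedPoly φ).roots.map (derivAt φ) +
    Multiset.replicate ((fixedPoly (atInfty φ)).rootMultiplicity 0) (derivAt (atInfty φ) 0)

variable {K : Type*} [Field K]

/-- A rational map over `K`, viewed over the algebraic closure of `K`. -/
def toBar (φ : RatFunc K) : RatFunc (AlgebraicClosure K) :=
  RatFunc.mapRingHom (mapRingHom (algebraMap K (AlgebraicClosure K)))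
    (nonZeroDivisors_le_comap_nonZeroDivisors_of_injective _
      (map_injective _ (algebraMap K (AlgebraicClosure K)).injective)) φ

/-- `l₁, l₂, l₃` is a listing of the multipliers of the fixed points of `φ` over the algebraic
closure of `K`, counted with multiplicity. -/
def HasMultipliers (φ : RatFunc K) (l₁ l₂ l₃ : AlgebraicClosure K) : Prop :=
  multipliers (toBar φ) = {l₁, l₂, l₃}

/-- The multipliers are distinct, or exactly two of them are `1`. -/
def CondA (l₁ l₂ l₃ : F) : Prop :=
  (l₁ ≠ l₂ ∧ l₁ ≠ l₃ ∧ l₂ ≠ l₃) ∨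
    (l₁ = 1 ∧ l₂ = 1 ∧ l₃ ≠ 1) ∨ (l₁ = 1 ∧ l₂ ≠ 1 ∧ l₃ = 1) ∨ (l₁ ≠ 1 ∧ l₂ = 1 ∧ l₃ = 1)

/-- `l₁ = l₂ ≠ 1` and `l₃ ≠ l₁`, or all three are `1`. -/
def CondB (l₁ l₂ l₃ : F) : Prop :=
  (l₁ = l₂ ∧ l₁ ≠ 1 ∧ l₃ ≠ l₁) ∨ (l₁ = 1 ∧ l₂ = 1 ∧ l₃ = 1)

/-- All three are `-2`. -/
def CondC (l₁ l₂ l₃ : F) : Prop := l₁ = -2 ∧ l₂ = -2 ∧ l₃ = -2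

/-- The map `φ` is in case (a). -/
def InCaseA (φ : RatFunc K) : Prop := ∃ l₁ l₂ l₃, HasMultipliers φ l₁ l₂ l₃ ∧ CondA l₁ l₂ l₃

/-- The map `φ` is in case (b). -/
def InCaseB (φ : RatFunc K) : Prop := ∃ l₁ l₂ l₃, HasMultipliers φ l₁ l₂ l₃ ∧ CondB l₁ l₂ l₃

/-- The map `φ` is in case (c). -/
def InCaseC (φ : RatFunc K) : Prop := ∃ l₁ l₂ l₃, HasMultipliers φ l₁ l₂ l₃ ∧ CondC l₁ l₂ l₃

/-- `(2 z² + (2 - s) z + (2 - s)) / (-z² + (2 + s) z + 2 - s - t)`. -/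
def formA (s t : K) : RatFunc K :=
  (2 * RatFunc.X ^ 2 + RatFunc.C (2 - s) * RatFunc.X + RatFunc.C (2 - s)) /
    (-RatFunc.X ^ 2 + RatFunc.C (2 + s) * RatFunc.X + RatFunc.C (2 - s - t))

/-- `k z + b / z`. -/
def formB (k b : K) : RatFunc K := RatFunc.C k * RatFunc.X + RatFunc.C b / RatFunc.X

/-- `θ_{d,k}(z) = (k z² - 2 d z + d k) / (z² - 2 k z + d)`. -/
def formC (d k : K) : RatFunc K :=
  (RatFunc.C k * RatFunc.X ^ 2 - RatFunc.C (2 * d) * RatFunc.X + RatFunc.C (d * k)) /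
    (RatFunc.X ^ 2 - RatFunc.C (2 * k) * RatFunc.X + RatFunc.C d)

end QuadraticMaps

end

/-!
A map of degree two lifts, uniquely up to a nonzero factor, to a pair `(P, Q)` of binary quadratic
forms with nonzero resultant. At a fixed vector, `P = μ x` and `Q = μ y`, Euler's identity makes
`2 μ` an eigenvalue of the differential of the lift, and the other one is `λ μ`, where `λ` is the
multiplier; hence the divergence `∂P/∂x + ∂Q/∂y`, a linear form `L`, takes the value `(2 + λ) μ`.

* If `L ≠ 0`, its zero is a point `p` of the projective line over the field of coefficients. If the
  image of `p` is not fixed, some Möbius function defined over that field sends every fixed point to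
  its multiplier; taking it as the coordinate gives `formA`. If the image of `p` is fixed, moving it
  to infinity and `p` to `0` gives `formB`.
* If `L = 0`, all multipliers are `-2`. In characteristic different from two the Jacobian of
  `(P, Q)`, a binary quadratic form, can be diagonalised, which gives `formC`.

The multipliers of the three normal forms satisfy the conditions of (a), (b) and (c), and determine
the parameters that are invariant over the algebraic closure. Over the field itself, a matrix
conjugating two maps `formB k b`, `formB k b'` respects the zero of `L` and is therefore triangular,
while one conjugating two maps `formC d k`, `formC d' k'` carries one Jacobian to a multiple of the
other.
-/

noncomputable section

namespace QuadraticMaps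

open Matrix Polynomial

variable {F : Type*} [Field F]

/-- The coefficients of a pair of binary quadratic forms
`(a x² + b x y + c y², d x² + e x y + f y²)`, a homogeneous lift of the rational map
`(a z² + b z + c) / (d z² + e z + f)`. -/
@[ext]
structure QuadPair (F : Type*) where
  a : F
  b : F
  c : F
  d : F
  e : F
  f : F

namespace QuadPair

instance : SMul F (QuadPair F) :=
  ⟨fun w q ↦ ⟨w * q.a, w * q.b, w * q.c, w * q.d, w * q.e, w * q.f⟩⟩

theorem smul_def (w : F) (q : QuadPair F) :
    w • q = ⟨w * q.a, w * q.b, w * q.c, w * q.d, w * q.e, w * q.f⟩ := rfl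

instance : MulAction F (QuadPair F) where
  one_smul q := by simp only [smul_def, one_mul]
  mul_smul w w' q := by simp only [smul_def, mul_assoc]

/-- Substitution of the linear forms `g *ᵥ ![x, y]` for the variables of a pair of forms. -/
def subst (q : QuadPair F) (g : Matrix (Fin 2) (Fin 2) F) : QuadPair F where
  a := q.a * g 0 0 ^ 2 + q.b * g 0 0 * g 1 0 + q.c * g 1 0 ^ 2
  b := 2 * q.a * g 0 0 * g 0 1 + q.b * (g 0 0 * g 1 1 + g 0 1 * g 1 0) + 2 * q.c * g 1 0 * g 1 1
  c := q.a * g 0 1 ^ 2 + q.b * g 0 1 * g 1 1 + q.c * g 1 1 ^ 2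
  d := q.d * g 0 0 ^ 2 + q.e * g 0 0 * g 1 0 + q.f * g 1 0 ^ 2
  e := 2 * q.d * g 0 0 * g 0 1 + q.e * (g 0 0 * g 1 1 + g 0 1 * g 1 0) + 2 * q.f * g 1 0 * g 1 1
  f := q.d * g 0 1 ^ 2 + q.e * g 0 1 * g 1 1 + q.f * g 1 1 ^ 2

/-- The linear combinations of a pair of forms `(P, Q)` with the rows of `g` as coefficients,
that is, the pair `g *ᵥ ![P, Q]`. -/
def comb (g : Matrix (Fin 2) (Fin 2) F) (q : QuadPair F) : QuadPair F where
  a := g 0 0 * q.a + g 0 1 * q.d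
  b := g 0 0 * q.b + g 0 1 * q.e
  c := g 0 0 * q.c + g 0 1 * q.f
  d := g 1 0 * q.a + g 1 1 * q.d
  e := g 1 0 * q.b + g 1 1 * q.e
  f := g 1 0 * q.c + g 1 1 * q.f

/-- Conjugation of a pair of forms by a matrix. The adjugate stands in for the inverse, so that no
denominators occur and the result differs from the conjugate by the factor `g.det`. -/
def act (q : QuadPair F) (g : Matrix (Fin 2) (Fin 2) F) : QuadPair F := comb g.adjugate (q.subst g)

theorem act_mul (q : QuadPair F) (g h : Matrix (Fin 2) (Fin 2) F) :
    q.act (g * h) = (q.act g).act h := by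
  simp only [act, subst, comb, adjugate_fin_two, mul_apply, Fin.sum_univ_two, of_apply, cons_val']
  ext <;> simp only [cons_val] <;> ring

theorem act_smul (w : F) (q : QuadPair F) (g : Matrix (Fin 2) (Fin 2) F) :
    (w • q).act g = w • q.act g := by
  simp only [act, subst, comb, smul_def]
  ext <;> ring

theorem act_scalar (q : QuadPair F) (t : F) : q.act (t • 1) = t ^ 3 • q := by
  simp only [act, subst, comb, smul_def, adjugate_fin_two, Matrix.smul_apply, one_fin_two, of_apply,
    cons_val, smul_eq_mul]
  ext <;> ring

theorem act_swap (q : QuadPair F) : q.act !![0, -1; -1, 0] = ⟨q.f, q.e, q.d, q.c, q.b, q.a⟩ := by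
  ext <;> simp [act, subst, comb, adjugate_fin_two]

/-- Conjugacy of the rational maps lifted by two pairs of forms: a lift is only determined up to a
nonzero factor. -/
def Rel (q q' : QuadPair F) : Prop :=
  ∃ (g : Matrix (Fin 2) (Fin 2) F) (w : F), g.det ≠ 0 ∧ w ≠ 0 ∧ q' = w • q.act g

theorem rel_act (q : QuadPair F) {g : Matrix (Fin 2) (Fin 2) F} (hg : g.det ≠ 0) :
    Rel q (q.act g) :=
  ⟨g, 1, hg, one_ne_zero, (one_smul F _).symm⟩

theorem rel_smul (q : QuadPair F) {w : F} (hw : w ≠ 0) : Rel q (w • q) :=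
  ⟨1, w, by simp, hw, by simpa using (congrArg (w • ·) (q.act_scalar 1)).symm⟩

theorem Rel.trans {q q' q'' : QuadPair F} (h : Rel q q') (h' : Rel q' q'') : Rel q q'' := by
  obtain ⟨g, w, hg, hw, rfl⟩ := h
  obtain ⟨g', w', hg', hw', rfl⟩ := h'
  refine ⟨g * g', w' * w, ?_, mul_ne_zero hw' hw, ?_⟩
  · rw [det_mul]
    exact mul_ne_zero hg hg'
  · rw [act_smul, act_mul, mul_smul]

theorem Rel.symm {q q' : QuadPair F} (h : Rel q q') : Rel q' q := by
  obtain ⟨g, w, hg, hw, rfl⟩ := h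
  refine ⟨g.adjugate, (w * g.det ^ 3)⁻¹, ?_, by positivity, ?_⟩
  · rwa [det_adjugate, Fintype.card_fin, pow_one]
  · rw [act_smul, ← act_mul, mul_adjugate, act_scalar, ← mul_smul, ← mul_smul, mul_assoc,
      inv_mul_cancel₀ (by positivity), one_smul]

/-- The resultant of the two quadratic forms. -/
def res (q : QuadPair F) : F :=
  (q.a * q.f - q.c * q.d) ^ 2 - (q.a * q.e - q.b * q.d) * (q.b * q.f - q.c * q.e)

theorem res_smul (w : F) (q : QuadPair F) : (w • q).res = w ^ 4 * q.res := by
  simp only [res, smul_def]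
  ring

theorem res_subst (q : QuadPair F) (g : Matrix (Fin 2) (Fin 2) F) :
    (q.subst g).res = g.det ^ 4 * q.res := by
  simp only [res, subst, det_fin_two]
  ring

theorem res_comb (g : Matrix (Fin 2) (Fin 2) F) (q : QuadPair F) :
    (comb g q).res = g.det ^ 2 * q.res := by
  simp only [res, comb, det_fin_two]
  ring

theorem res_act (q : QuadPair F) (g : Matrix (Fin 2) (Fin 2) F) :
    (q.act g).res = g.det ^ 6 * q.res := by
  rw [act, res_comb, res_subst, det_adjugate, Fintype.card_fin]
  ring

theorem Rel.res_ne_zero {q q' : QuadPair F} (h : Rel q q') (hq : q.res ≠ 0) : q'.res ≠ 0 := by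
  obtain ⟨g, w, hg, hw, rfl⟩ := h
  rw [res_smul, res_act]
  positivity

/-- The values `![P u, Q u]` at a vector `u` of a pair of forms `(P, Q)`. -/
def eval (q : QuadPair F) (u : Fin 2 → F) : Fin 2 → F :=
  ![q.a * u 0 ^ 2 + q.b * u 0 * u 1 + q.c * u 1 ^ 2,
    q.d * u 0 ^ 2 + q.e * u 0 * u 1 + q.f * u 1 ^ 2]

theorem eval_act (q : QuadPair F) (g : Matrix (Fin 2) (Fin 2) F) (u : Fin 2 → F) :
    (q.act g).eval u = g.adjugate *ᵥ q.eval (g *ᵥ u) := by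
  ext i
  fin_cases i <;>
    simp only [eval, act, subst, comb, adjugate_fin_two, mulVec, dotProduct, Fin.sum_univ_two,
      of_apply, cons_val, Fin.zero_eta, Fin.mk_one] <;>
    ring

theorem smul_eval (w : F) (q : QuadPair F) (u : Fin 2 → F) : (w • q).eval u = w • q.eval u := by
  ext i
  fin_cases i <;>
    simp only [eval, smul_def, Pi.smul_apply, smul_eq_mul, cons_val, Fin.zero_eta, Fin.mk_one] <;>
    ring

theorem eval_smul (q : QuadPair F) (t : F) (u : Fin 2 → F) : q.eval (t • u) = t ^ 2 • q.eval u := by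
  ext i
  fin_cases i <;>
    simp only [eval, Pi.smul_apply, smul_eq_mul, cons_val, Fin.zero_eta, Fin.mk_one] <;> ring

/-- The divergence `∂P/∂x + ∂Q/∂y` of a pair of forms `(P, Q)`. -/
def divergence (q : QuadPair F) (u : Fin 2 → F) : F :=
  (2 * q.a + q.e) * u 0 + (q.b + 2 * q.f) * u 1

theorem divergence_act (q : QuadPair F) (g : Matrix (Fin 2) (Fin 2) F) (u : Fin 2 → F) :
    (q.act g).divergence u = g.det * q.divergence (g *ᵥ u) := by
  simp only [divergence, act, subst, comb, adjugate_fin_two, det_fin_two, mulVec, dotProduct,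
    Fin.sum_univ_two, of_apply, cons_val]
  ring

theorem smul_divergence (w : F) (q : QuadPair F) (u : Fin 2 → F) :
    (w • q).divergence u = w * q.divergence u := by
  simp only [divergence, smul_def]
  ring

/-- The polar form of the Jacobian determinant `(P_x Q_y - P_y Q_x) / 2` of a pair of forms
`(P, Q)`. -/
def jacobian (q : QuadPair F) (u v : Fin 2 → F) : F :=
  (q.a * q.e - q.b * q.d) * (u 0 * v 0) + (q.a * q.f - q.c * q.d) * (u 0 * v 1 + u 1 * v 0) +
    (q.b * q.f - q.c * q.e) * (u 1 * v 1)

theorem jacobian_act (q : QuadPair F) (g : Matrix (Fin 2) (Fin 2) F) (u v : Fin 2 → F) :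
    (q.act g).jacobian u v = g.det ^ 2 * q.jacobian (g *ᵥ u) (g *ᵥ v) := by
  simp only [jacobian, act, subst, comb, adjugate_fin_two, det_fin_two, mulVec, dotProduct,
    Fin.sum_univ_two, of_apply, cons_val]
  ring

theorem smul_jacobian (w : F) (q : QuadPair F) (u v : Fin 2 → F) :
    (w • q).jacobian u v = w ^ 2 * q.jacobian u v := by
  simp only [jacobian, smul_def]
  ring

/-- The lift of `formA s t`. -/
def ofA (s t : F) : QuadPair F := ⟨2, 2 - s, 2 - s, -1, 2 + s, 2 - s - t⟩

/-- The lift of `formB k b`. -/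
def ofB (k b : F) : QuadPair F := ⟨k, 0, b, 0, 1, 0⟩

/-- The lift of `formC d k`. -/
def ofC (d k : F) : QuadPair F := ⟨k, -(2 * d), d * k, 1, -(2 * k), d⟩

theorem exists_rel_ofA_of_coeff_eq {q : QuadPair F} (hd : q.d ≠ 0) (ha : q.a = -(2 * q.d))
    (hbc : q.b = q.c) (hbe : q.b + q.e = -(4 * q.d)) : ∃ s t, Rel q (ofA s t) := by
  refine ⟨2 + q.b / q.d, q.f / q.d - q.b / q.d, ?_⟩
  convert q.rel_smul (neg_ne_zero.2 (inv_ne_zero hd)) using 1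
  ext <;> simp only [ofA, smul_def] <;> field_simp
  · linear_combination ha
  · ring
  · linear_combination -hbc
  · linear_combination hbe
  · ring

theorem exists_rel_ofB_of_coeff_eq {q : QuadPair F} (h2 : (2 : F) ≠ 0) (hr : q.res ≠ 0)
    (hb : q.b = 0) (hd : q.d = 0) (hf : q.f = 0) (h_div : 2 * q.a + q.e ≠ 0) :
    ∃ k b, k ≠ 0 ∧ k ≠ -1 / 2 ∧ b ≠ 0 ∧ Rel q (ofB k b) := by
  have hres : q.res = q.a * q.c * q.e ^ 2 := by
    simp only [res, hb, hd, hf]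
    ring
  obtain ⟨⟨ha, hc⟩, he⟩ : (q.a ≠ 0 ∧ q.c ≠ 0) ∧ q.e ≠ 0 := by simpa [hres] using hr
  refine ⟨q.a / q.e, q.c / q.e, div_ne_zero ha he, ?_, div_ne_zero hc he, ?_⟩
  · rw [ne_eq, div_eq_div_iff he h2]
    intro h
    exact h_div (by linear_combination h)
  · convert q.rel_smul (inv_ne_zero he) using 1
    ext <;> simp only [ofB, smul_def, hb, hd, hf] <;> field_simp <;> ring

theorem rel_ofC_of_coeff_eq {q : QuadPair F} (hd : q.d ≠ 0) (he : q.e = -(2 * q.a))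
    (hb : q.b = -(2 * q.f)) (hm : q.a * q.f - q.c * q.d = 0) :
    Rel q (ofC (q.f / q.d) (q.a / q.d)) := by
  convert q.rel_smul (inv_ne_zero hd) using 1
  ext <;> simp only [ofC, smul_def, hb, he] <;> field_simp
  linear_combination hm

theorem exists_rel_divergence_eq_zero {q : QuadPair F} {u : Fin 2 → F} (hu : q.divergence u ≠ 0) :
    ∃ q', Rel q q' ∧ q'.divergence ![1, 0] = 0 ∧ q'.divergence ![0, 1] ≠ 0 := by
  set g : Matrix (Fin 2) (Fin 2) F := !![-(q.b + 2 * q.f), u 0; 2 * q.a + q.e, u 1]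
  have hg : g.det = -q.divergence u := by
    simp only [g, det_fin_two_of, divergence]
    ring
  have hg_zero : q.divergence (g *ᵥ ![1, 0]) = 0 := by
    simp only [g, divergence, mulVec, dotProduct, Fin.sum_univ_two, of_apply, cons_val]
    ring
  have hg_one : g *ᵥ ![0, 1] = u := by
    ext i
    fin_cases i <;> simp [g, mulVec, dotProduct]
  have hg_ne : g.det ≠ 0 := by rwa [hg, neg_ne_zero]
  refine ⟨_, q.rel_act hg_ne, ?_, ?_⟩
  · rw [divergence_act, hg_zero, mul_zero]
  · rw [divergence_act, hg_one]
    exact mul_ne_zero hg_ne hu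

/-- The value of `y P - x Q` at the image `(a, d)` of the point at infinity, divided by `d`: for
`d ≠ 0` it vanishes exactly when this image is a fixed point. -/
def imageDefect (q : QuadPair F) : F :=
  q.a * q.d * (q.b - q.f) + q.c * q.d ^ 2 - q.a ^ 2 * q.e

-- In `ofA s t` the fixed point of multiplier `l` is `l` itself. Eliminating `x²` from `P = μ x` and
-- `Q = μ y` expresses the multiplier `(b + 2 f) y / μ - 2` of a fixed point as a Möbius function of
-- it, and `q` is conjugated by the inverse of that function.
theorem exists_rel_ofA_of_imageDefect_ne_zero {q : QuadPair F} (hr : q.res ≠ 0)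
    (he : q.e = -(2 * q.a)) (hn : q.b + 2 * q.f ≠ 0) (hκ : q.imageDefect ≠ 0) :
    ∃ s t, Rel q (ofA s t) := by
  obtain ⟨a, b, c, d, e, f⟩ := q
  obtain rfl : e = -(2 * a) := he
  set g : Matrix (Fin 2) (Fin 2) F := adjugate
    !![-((b + 2 * f) * d) + 2 * (2 * a ^ 2 + b * d), (b + 2 * f) * a - 2 * (a * f - d * c);
      -(2 * a ^ 2 + b * d), a * f - d * c]
  set q : QuadPair F := ⟨a, b, c, d, -(2 * a), f⟩
  have hg : g.det = (b + 2 * f) * q.imageDefect := by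
    simp only [g, q, imageDefect, det_adjugate, det_fin_two_of, Fintype.card_fin]
    ring
  have hgd : (q.act g).d = -(q.imageDefect * q.res) := by
    simp only [g, q, imageDefect, res, act, subst, comb, adjugate_fin_two, of_apply, cons_val]
    ring
  obtain ⟨s, t, h⟩ : ∃ s t, Rel (q.act g) (ofA s t) := by
    refine exists_rel_ofA_of_coeff_eq (by rw [hgd, neg_ne_zero]; positivity) ?_ ?_ ?_ <;>
    · simp only [g, q, act, subst, comb, adjugate_fin_two, of_apply, cons_val]
      ring
  exact ⟨s, t, (q.rel_act (by rw [hg]; positivity)).trans h⟩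

theorem exists_rel_ofB_of_imageDefect_eq_zero {q : QuadPair F} (h2 : (2 : F) ≠ 0) (hr : q.res ≠ 0)
    (he : q.e = -(2 * q.a)) (hn : q.b + 2 * q.f ≠ 0) (hκ : q.imageDefect = 0) :
    ∃ k b, k ≠ 0 ∧ k ≠ -1 / 2 ∧ b ≠ 0 ∧ Rel q (ofB k b) := by
  obtain ⟨a, b, c, d, e, f⟩ := q
  obtain rfl : e = -(2 * a) := he
  have hd : d ≠ 0 := by
    rintro rfl
    have ha : a = 0 := by
      refine pow_eq_zero_iff three_ne_zero |>.1 ((mul_eq_zero_iff_left h2).1 ?_)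
      simp only [imageDefect] at hκ
      linear_combination hκ
    simp [res, ha] at hr
  set q : QuadPair F := ⟨a, b, c, d, -(2 * a), f⟩
  set g : Matrix (Fin 2) (Fin 2) F := !![a, 1; d, 0]
  have hrel : Rel q (q.act g) := q.rel_act (by simpa [g] using hd)
  have hd' : (q.act g).d = -d * q.imageDefect := by
    simp only [g, q, act, subst, comb, adjugate_fin_two, imageDefect, of_apply, cons_val]
    ring
  have h_div : 2 * (q.act g).a + (q.act g).e = -d ^ 2 * (b + 2 * f) := by
    simp only [g, q, act, subst, comb, adjugate_fin_two, of_apply, cons_val]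
    ring
  obtain ⟨k, b, hk, hk', hb, h⟩ : ∃ k b, k ≠ 0 ∧ k ≠ -1 / 2 ∧ b ≠ 0 ∧ Rel (q.act g) (ofB k b) := by
    refine exists_rel_ofB_of_coeff_eq h2 (hrel.res_ne_zero hr) ?_ (by rw [hd', hκ, mul_zero]) ?_
      (by rw [h_div]; exact mul_ne_zero (neg_ne_zero.2 (pow_ne_zero 2 hd)) hn) <;>
    · simp only [g, q, act, subst, comb, adjugate_fin_two, of_apply, cons_val]
      ring
  exact ⟨k, b, hk, hk', hb, hrel.trans h⟩

theorem exists_jacobian_self_ne_zero {q : QuadPair F} (h2 : (2 : F) ≠ 0) (hr : q.res ≠ 0) :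
    ∃ u, q.jacobian u u ≠ 0 := by
  by_contra! h
  have h10 : q.a * q.e - q.b * q.d = 0 := by simpa [jacobian] using h ![1, 0]
  have h01 : q.b * q.f - q.c * q.e = 0 := by simpa [jacobian] using h ![0, 1]
  have h11 := h ![1, 1]
  have hm : q.a * q.f - q.c * q.d = 0 := by
    refine (mul_eq_zero_iff_left h2).1 ?_
    simp only [jacobian, cons_val_zero, cons_val_one] at h11
    linear_combination h11 - h10 - h01
  exact hr (by rw [res, hm, h10]; ring)

theorem exists_rel_jacobian_eq_zero {q : QuadPair F} (h2 : (2 : F) ≠ 0) (hr : q.res ≠ 0) :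
    ∃ g : Matrix (Fin 2) (Fin 2) F, g.det ≠ 0 ∧ (q.act g).jacobian ![1, 0] ![0, 1] = 0 := by
  obtain ⟨u, hu⟩ := exists_jacobian_self_ne_zero h2 hr
  set v : Fin 2 → F := ![-((q.a * q.f - q.c * q.d) * u 0 + (q.b * q.f - q.c * q.e) * u 1),
    (q.a * q.e - q.b * q.d) * u 0 + (q.a * q.f - q.c * q.d) * u 1]
  have h_orthogonal : q.jacobian u v = 0 := by
    simp only [v, jacobian, cons_val]
    ring
  set g : Matrix (Fin 2) (Fin 2) F := !![u 0, v 0; u 1, v 1]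
  have hg : g.det = q.jacobian u u := by
    simp only [g, v, det_fin_two_of, jacobian, cons_val]
    ring
  refine ⟨g, by rwa [hg], ?_⟩
  have hg_u : g *ᵥ ![1, 0] = u := by
    ext i
    fin_cases i <;> simp [g, mulVec, dotProduct]
  have hg_v : g *ᵥ ![0, 1] = v := by
    ext i
    fin_cases i <;> simp [g, mulVec, dotProduct]
  rw [jacobian_act, hg_u, hg_v, h_orthogonal, mul_zero]

theorem rel_ofC_of_diagonal {q : QuadPair F} (hr : q.res ≠ 0) (he : q.e = -(2 * q.a))
    (hb : q.b = -(2 * q.f)) (hm : q.a * q.f - q.c * q.d = 0) (hd : q.d ≠ 0) :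
    ∃ d k, d ≠ 0 ∧ k ^ 2 ≠ d ∧ Rel q (ofC d k) := by
  have hres : q.d * q.res = 4 * q.f * (q.a ^ 2 - q.f * q.d) ^ 2 := by
    rw [res, he, hb]
    linear_combination
      (q.d * (q.a * q.f - q.c * q.d) + 4 * q.a * (q.f * q.d - q.a ^ 2)) * hm
  have hne : 4 * q.f * (q.a ^ 2 - q.f * q.d) ^ 2 ≠ 0 := hres ▸ mul_ne_zero hd hr
  refine ⟨_, _, div_ne_zero ?_ hd, ?_, rel_ofC_of_coeff_eq hd he hb hm⟩
  · intro hf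
    simp [hf] at hne
  · intro h
    field_simp at h
    simp [h, mul_comm] at hne

theorem exists_rel_ofC_of_divergence_eq_zero {q : QuadPair F} (h2 : (2 : F) ≠ 0) (hr : q.res ≠ 0)
    (hL : ∀ u, q.divergence u = 0) : ∃ d k, d ≠ 0 ∧ k ^ 2 ≠ d ∧ Rel q (ofC d k) := by
  obtain ⟨g, hg, hJ⟩ := exists_rel_jacobian_eq_zero h2 hr
  have hrel := q.rel_act hg
  have hL' (u) : (q.act g).divergence u = 0 := by rw [divergence_act, hL, mul_zero]
  generalize q.act g = q' at hrel hJ hL'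
  have hr' := hrel.res_ne_zero hr
  have he : q'.e = -(2 * q'.a) := by
    have h := hL' ![1, 0]
    simp only [divergence, cons_val_zero, cons_val_one] at h
    linear_combination h
  have hb : q'.b = -(2 * q'.f) := by
    have h := hL' ![0, 1]
    simp only [divergence, cons_val_zero, cons_val_one] at h
    linear_combination h
  have hm : q'.a * q'.f - q'.c * q'.d = 0 := by simpa [jacobian] using hJ
  by_cases hd : q'.d = 0
  · have hc : q'.c ≠ 0 := by
      intro hc
      refine hr' ?_
      have haf : q'.a * q'.f = 0 := by simpa [hd] using hm
      rw [res, hd, hc, he, hb]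
      linear_combination (-3 * q'.a * q'.f) * haf
    have hswap := q'.rel_act (g := !![0, -1; -1, 0]) (by simp)
    rw [act_swap] at hswap
    obtain ⟨d, k, hd, hk, h⟩ := rel_ofC_of_diagonal (hswap.res_ne_zero hr')
      (by linear_combination hb) (by linear_combination he) (by linear_combination hm) hc
    exact ⟨d, k, hd, hk, hrel.trans (hswap.trans h)⟩
  · obtain ⟨d, k, hd, hk, h⟩ := rel_ofC_of_diagonal hr' he hb hm hd
    exact ⟨d, k, hd, hk, hrel.trans h⟩

theorem rel_normal_form {q : QuadPair F} (h2 : (2 : F) ≠ 0) (hr : q.res ≠ 0) :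
    (∃ s t, Rel q (ofA s t)) ∨ (∃ k b, k ≠ 0 ∧ k ≠ -1 / 2 ∧ b ≠ 0 ∧ Rel q (ofB k b)) ∨
      ∃ d k, d ≠ 0 ∧ k ^ 2 ≠ d ∧ Rel q (ofC d k) := by
  by_cases hL : ∀ u, q.divergence u = 0
  · exact .inr (.inr (exists_rel_ofC_of_divergence_eq_zero h2 hr hL))
  · push Not at hL
    obtain ⟨u, hu⟩ := hL
    obtain ⟨q', hq', h10, h01⟩ := exists_rel_divergence_eq_zero hu
    have hr' := hq'.res_ne_zero hr
    have he : q'.e = -(2 * q'.a) := by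
      simp only [divergence, cons_val_zero, cons_val_one] at h10
      linear_combination h10
    have hn : q'.b + 2 * q'.f ≠ 0 := by simpa [divergence] using h01
    by_cases hκ : q'.imageDefect = 0
    · obtain ⟨k, b, hk, hk', hb, h⟩ := exists_rel_ofB_of_imageDefect_eq_zero h2 hr' he hn hκ
      exact .inr (.inl ⟨k, b, hk, hk', hb, hq'.trans h⟩)
    · obtain ⟨s, t, h⟩ := exists_rel_ofA_of_imageDefect_ne_zero hr' he hn hκ
      exact .inl ⟨s, t, hq'.trans h⟩

end QuadPair

theorem num_div_of_isCoprime {p q : F[X]} (h : IsCoprime p q) :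
    (algebraMap F[X] (RatFunc F) p / algebraMap F[X] (RatFunc F) q).num =
      C q.leadingCoeff⁻¹ * p := by
  classical
  have hgcd : gcd p q = 1 := by
    rwa [← normalize_gcd, normalize_eq_one, gcd_isUnit_iff]
  rw [RatFunc.num_div, hgcd, EuclideanDomain.div_one, EuclideanDomain.div_one]

theorem denom_div_of_isCoprime {p q : F[X]} (h : IsCoprime p q) (hq : q ≠ 0) :
    (algebraMap F[X] (RatFunc F) p / algebraMap F[X] (RatFunc F) q).denom =
      C q.leadingCoeff⁻¹ * q := by
  classical
  have hgcd : gcd p q = 1 := by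
    rwa [← normalize_gcd, normalize_eq_one, gcd_isUnit_iff]
  rw [RatFunc.denom_div p hq, hgcd, EuclideanDomain.div_one]

theorem ratDegree_div_le_one {p q : F[X]} (hp : p.natDegree ≤ 1) (hq : q.natDegree ≤ 1)
    (hq0 : q ≠ 0) :
    ratDegree (algebraMap F[X] (RatFunc F) p / algebraMap F[X] (RatFunc F) q) ≤ 1 := by
  refine max_le ?_ ((natDegree_le_of_dvd (RatFunc.denom_div_dvd p q) hq0).trans hq)
  rcases eq_or_ne p 0 with rfl | hp0
  · simp
  · exact (natDegree_le_of_dvd (RatFunc.num_div_dvd p hq0) hp0).trans hp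

theorem ratComp_div {p q : F[X]} (h : IsCoprime p q) (hq : q ≠ 0) (g : RatFunc F) :
    ratComp (algebraMap F[X] (RatFunc F) p / algebraMap F[X] (RatFunc F) q) g =
      p.eval₂ RatFunc.C g / q.eval₂ RatFunc.C g := by
  rw [ratComp, RatFunc.eval, num_div_of_isCoprime h, denom_div_of_isCoprime h hq, eval₂_mul,
    eval₂_mul, eval₂_C]
  exact mul_div_mul_left _ _ (by simpa using hq)

theorem linear_eq_zero_iff {a b : F} : (C a * X + C b : F[X]) = 0 ↔ a = 0 ∧ b = 0 := by
  refine ⟨fun h ↦ ⟨?_, ?_⟩, by rintro ⟨rfl, rfl⟩; simp⟩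
  · simpa [coeff_C] using congrArg (coeff · 1) h
  · simpa using congrArg (coeff · 0) h

theorem isCoprime_linear {a b c d : F} (h : a * d - b * c ≠ 0) :
    IsCoprime (C a * X + C b) (C c * X + C d) := by
  refine ⟨C (a * d - b * c)⁻¹ * -C c, C (a * d - b * c)⁻¹ * C a, ?_⟩
  calc _ = C (a * d - b * c)⁻¹ * C (a * d - b * c) := by
        simp only [C_sub, C_mul]
        ring
    _ = 1 := by rw [← C_mul, inv_mul_cancel₀ h, C_1]

theorem mobius_denominator_ne_zero (h : GL (Fin 2) F) : (C (h 1 0) * X + C (h 1 1) : F[X]) ≠ 0 := by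
  intro h0
  have hdet := h.det_ne_zero
  simp [det_fin_two, linear_eq_zero_iff.1 h0] at hdet

theorem ratComp_mobius (h : GL (Fin 2) F) (g : RatFunc F) :
    ratComp (mobius h) g = (RatFunc.C (h 0 0) * g + RatFunc.C (h 0 1)) /
      (RatFunc.C (h 1 0) * g + RatFunc.C (h 1 1)) := by
  have hdet : h 0 0 * h 1 1 - h 0 1 * h 1 0 ≠ 0 := by
    rw [← det_fin_two]
    exact h.det_ne_zero
  simpa [mobius] using ratComp_div (isCoprime_linear hdet) (mobius_denominator_ne_zero h) g

theorem eval₂_quadratic_div {n d : RatFunc F} (hd : d ≠ 0) (a b c : F) :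
    eval₂ RatFunc.C (n / d) (C a * X ^ 2 + C b * X + C c) =
      (RatFunc.C a * n ^ 2 + RatFunc.C b * n * d + RatFunc.C c * d ^ 2) / d ^ 2 := by
  simp only [eval₂_add, eval₂_mul, eval₂_C, eval₂_pow, eval₂_X]
  field_simp

namespace QuadPair

/-- The numerator of the rational map lifted by a pair of forms. -/
def num (q : QuadPair F) : F[X] := C q.a * X ^ 2 + C q.b * X + C q.c

/-- The denominator of the rational map lifted by a pair of forms. -/
def den (q : QuadPair F) : F[X] := C q.d * X ^ 2 + C q.e * X + C q.f

/-- The rational map lifted by a pair of forms. -/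
def toRat (q : QuadPair F) : RatFunc F :=
  algebraMap F[X] (RatFunc F) q.num / algebraMap F[X] (RatFunc F) q.den

theorem isCoprime_num_den {q : QuadPair F} (hq : q.res ≠ 0) : IsCoprime q.num q.den := by
  set p := q.a * q.e - q.b * q.d with hp
  set m := q.a * q.f - q.c * q.d with hm
  refine ⟨C q.res⁻¹ * (-C (m * q.d) + C p * (C q.d * X + C q.e)),
    C q.res⁻¹ * (C (m * q.a) - C p * (C q.a * X + C q.b)), ?_⟩
  calc _ = C q.res⁻¹ * C q.res := by
        simp only [num, den, hp, hm, res, C_mul, C_sub, C_pow]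
        ring
    _ = 1 := by rw [← C_mul, inv_mul_cancel₀ hq, C_1]

theorem a_ne_zero_or_d_ne_zero {q : QuadPair F} (hq : q.res ≠ 0) : q.a ≠ 0 ∨ q.d ≠ 0 := by
  by_contra! h
  simp [res, h] at hq

theorem den_ne_zero {q : QuadPair F} (hq : q.res ≠ 0) : q.den ≠ 0 := by
  intro h
  obtain ⟨hd, he, hf⟩ : q.d = 0 ∧ q.e = 0 ∧ q.f = 0 := by
    refine ⟨?_, ?_, ?_⟩
    · simpa [den, coeff_X, coeff_C] using congrArg (coeff · 2) h
    · simpa [den, coeff_X, coeff_C] using congrArg (coeff · 1) h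
    · simpa [den, coeff_X, coeff_C] using congrArg (coeff · 0) h
  simp [res, hd, he, hf] at hq

theorem num_toRat {q : QuadPair F} (hq : q.res ≠ 0) :
    q.toRat.num = C q.den.leadingCoeff⁻¹ * q.num :=
  num_div_of_isCoprime (isCoprime_num_den hq)

theorem denom_toRat {q : QuadPair F} (hq : q.res ≠ 0) :
    q.toRat.denom = C q.den.leadingCoeff⁻¹ * q.den :=
  denom_div_of_isCoprime (isCoprime_num_den hq) (den_ne_zero hq)

theorem inv_leadingCoeff_den_ne_zero {q : QuadPair F} (hq : q.res ≠ 0) :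
    q.den.leadingCoeff⁻¹ ≠ 0 :=
  inv_ne_zero (leadingCoeff_ne_zero.2 (den_ne_zero hq))

theorem ratDegree_toRat {q : QuadPair F} (hq : q.res ≠ 0) : ratDegree q.toRat = 2 := by
  have hc := inv_leadingCoeff_den_ne_zero hq
  rw [ratDegree, num_toRat hq, denom_toRat hq, natDegree_C_mul hc, natDegree_C_mul hc]
  have hnum : q.num.natDegree ≤ 2 := natDegree_quadratic_le
  have hden : q.den.natDegree ≤ 2 := natDegree_quadratic_le
  rcases a_ne_zero_or_d_ne_zero hq with h | h
  · rw [show q.num.natDegree = 2 from natDegree_quadratic h, max_eq_left hden]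
  · rw [show q.den.natDegree = 2 from natDegree_quadratic h, max_eq_right hnum]

/-- The Sylvester matrix of the two forms: it sends the coefficients of `(v₁ X + v₀, u₁ X + u₀)` to
those of `(v₁ X + v₀) * q.den - (u₁ X + u₀) * q.num`. -/
def sylvester (q : QuadPair F) : Matrix (Fin 4) (Fin 4) F :=
  !![q.d, 0, -q.a, 0; q.e, q.d, -q.b, -q.a; q.f, q.e, -q.c, -q.b; 0, q.f, 0, -q.c]

theorem det_sylvester (q : QuadPair F) : q.sylvester.det = q.res := by
  simp [sylvester, det_succ_row_zero, Fin.sum_univ_succ, Fin.succAbove, res]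
  ring

theorem exists_linear_syzygy {q : QuadPair F} (hq : q.res = 0) :
    ∃ U V : F[X], U.natDegree ≤ 1 ∧ V.natDegree ≤ 1 ∧ (U ≠ 0 ∨ V ≠ 0) ∧
      U * q.num = V * q.den := by
  obtain ⟨v, hv, hqv⟩ := exists_mulVec_eq_zero_iff.2 (q.det_sylvester.trans hq)
  refine ⟨C (v 2) * X + C (v 3), C (v 0) * X + C (v 1), natDegree_linear_le, natDegree_linear_le,
    ?_, ?_⟩
  · contrapose! hv
    obtain ⟨⟨h2, h3⟩, h0, h1⟩ := hv.imp linear_eq_zero_iff.1 linear_eq_zero_iff.1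
    ext i
    fin_cases i <;> assumption
  · have h_expand : (C (v 0) * X + C (v 1)) * q.den - (C (v 2) * X + C (v 3)) * q.num =
        C ((q.sylvester *ᵥ v) 0) * X ^ 3 + C ((q.sylvester *ᵥ v) 1) * X ^ 2 +
          C ((q.sylvester *ᵥ v) 2) * X + C ((q.sylvester *ᵥ v) 3) := by
      simp [sylvester, mulVec, dotProduct, Fin.sum_univ_succ, num, den]
      ring
    simp only [hqv, Pi.zero_apply, C_0, zero_mul, add_zero, sub_eq_zero] at h_expand
    exact h_expand.symm

theorem res_ne_zero_of_ratDegree {q : QuadPair F} (h : ratDegree q.toRat = 2) : q.res ≠ 0 := by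
  intro hq
  have hden : q.den ≠ 0 := by
    intro h0
    simp [toRat, h0, ratDegree] at h
  obtain ⟨U, V, hU, hV, hUV, hsyz⟩ := exists_linear_syzygy hq
  have hU0 : U ≠ 0 := by
    rintro rfl
    simp_all
  have hrat : q.toRat = algebraMap F[X] (RatFunc F) V / algebraMap F[X] (RatFunc F) U := by
    rw [toRat, div_eq_div_iff (RatFunc.algebraMap_ne_zero hden) (RatFunc.algebraMap_ne_zero hU0),
      ← map_mul, ← map_mul, mul_comm, hsyz]
  have := ratDegree_div_le_one hV hU hU0
  rw [← hrat] at this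
  lia

theorem exists_toRat_eq {ψ : RatFunc F} (h : ratDegree ψ = 2) :
    ∃ q : QuadPair F, q.res ≠ 0 ∧ q.toRat = ψ := by
  have hnum : ψ.num.natDegree ≤ 2 := h ▸ le_max_left _ _
  have hden : ψ.denom.natDegree ≤ 2 := h ▸ le_max_right _ _
  let q : QuadPair F := ⟨ψ.num.coeff 2, ψ.num.coeff 1, ψ.num.coeff 0, ψ.denom.coeff 2,
    ψ.denom.coeff 1, ψ.denom.coeff 0⟩
  have hq : q.toRat = ψ := by
    rw [← ψ.num_div_denom, eq_quadratic_of_degree_le_two (natDegree_le_iff_degree_le.1 hnum),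
      eq_quadratic_of_degree_le_two (natDegree_le_iff_degree_le.1 hden)]
    rfl
  exact ⟨q, res_ne_zero_of_ratDegree (hq.symm ▸ h), hq⟩

theorem num_smul (w : F) (q : QuadPair F) : (w • q).num = C w * q.num := by
  simp only [num, smul_def, C_mul]
  ring

theorem den_smul (w : F) (q : QuadPair F) : (w • q).den = C w * q.den := by
  simp only [den, smul_def, C_mul]
  ring

theorem toRat_smul {w : F} (hw : w ≠ 0) (q : QuadPair F) : (w • q).toRat = q.toRat := by
  rw [toRat, num_smul, den_smul, map_mul, map_mul]
  exact mul_div_mul_left _ _ (by simpa using hw)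

theorem ext_of_num_den {q q' : QuadPair F} (hnum : q.num = q'.num) (hden : q.den = q'.den) :
    q = q' := by
  ext
  · simpa [num, coeff_X, coeff_C] using congrArg (coeff · 2) hnum
  · simpa [num, coeff_X, coeff_C] using congrArg (coeff · 1) hnum
  · simpa [num, coeff_X, coeff_C] using congrArg (coeff · 0) hnum
  · simpa [den, coeff_X, coeff_C] using congrArg (coeff · 2) hden
  · simpa [den, coeff_X, coeff_C] using congrArg (coeff · 1) hden
  · simpa [den, coeff_X, coeff_C] using congrArg (coeff · 0) hden

theorem exists_smul_eq_of_toRat_eq {q q' : QuadPair F} (hq : q.res ≠ 0) (hq' : q'.res ≠ 0)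
    (h : q.toRat = q'.toRat) : ∃ w : F, w ≠ 0 ∧ q' = w • q := by
  have hc := inv_leadingCoeff_den_ne_zero hq
  have hc' := inv_leadingCoeff_den_ne_zero hq'
  have hnum := congrArg RatFunc.num h
  have hden := congrArg RatFunc.denom h
  rw [num_toRat hq, num_toRat hq', ← num_smul, ← num_smul] at hnum
  rw [denom_toRat hq, denom_toRat hq', ← den_smul, ← den_smul] at hden
  refine ⟨_, mul_ne_zero (inv_ne_zero hc') hc, ?_⟩
  rw [mul_smul, ext_of_num_den hnum hden, inv_smul_smul₀ hc']

theorem ratComp_toRat_mobius {q : QuadPair F} (hq : q.res ≠ 0) (h : GL (Fin 2) F) :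
    ratComp q.toRat (mobius h) = (q.subst h).toRat := by
  have hD : RatFunc.C (h 1 0) * RatFunc.X + RatFunc.C (h 1 1) ≠ 0 := by
    rw [← RatFunc.algebraMap_C, ← RatFunc.algebraMap_C, ← RatFunc.algebraMap_X, ← map_mul,
      ← map_add]
    exact RatFunc.algebraMap_ne_zero (mobius_denominator_ne_zero h)
  rw [toRat, ratComp_div (isCoprime_num_den hq) (den_ne_zero hq), num, den, mobius,
    eval₂_quadratic_div hD, eval₂_quadratic_div hD, div_div_div_cancel_right₀ (pow_ne_zero 2 hD),
    toRat]
  congr 1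
  · simp only [num, subst, map_add, map_mul, map_pow, map_ofNat (RatFunc.C : F →+* RatFunc F) 2,
      RatFunc.algebraMap_C, RatFunc.algebraMap_X]
    ring
  · simp only [den, subst, map_add, map_mul, map_pow, map_ofNat (RatFunc.C : F →+* RatFunc F) 2,
      RatFunc.algebraMap_C, RatFunc.algebraMap_X]
    ring

theorem toRat_comb {q : QuadPair F} (hq : q.den ≠ 0) (g : Matrix (Fin 2) (Fin 2) F) :
    (comb g q).toRat = (RatFunc.C (g 0 0) * q.toRat + RatFunc.C (g 0 1)) /
      (RatFunc.C (g 1 0) * q.toRat + RatFunc.C (g 1 1)) := by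
  have h_comb (r s : F) : RatFunc.C r * q.toRat + RatFunc.C s =
      algebraMap F[X] (RatFunc F) (C r * q.num + C s * q.den) /
        algebraMap F[X] (RatFunc F) q.den := by
    have := RatFunc.algebraMap_ne_zero hq
    simp only [toRat, map_add, map_mul, RatFunc.algebraMap_C]
    field_simp
  rw [h_comb, h_comb, div_div_div_cancel_right₀ (RatFunc.algebraMap_ne_zero hq), toRat]
  congr 2
  · simp only [num, den, comb, C_add, C_mul]
    ring
  · simp only [num, den, comb, C_add, C_mul]
    ring

theorem comb_smul (w : F) (g : Matrix (Fin 2) (Fin 2) F) (q : QuadPair F) :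
    comb (w • g) q = w • comb g q := by
  simp only [comb, smul_def, Matrix.smul_apply, smul_eq_mul]
  ext <;> ring

theorem conjBy_toRat {q : QuadPair F} (hq : q.res ≠ 0) (h : GL (Fin 2) F) :
    conjBy h q.toRat = (q.act h).toRat := by
  have h_subst : (q.subst h).res ≠ 0 := by
    rw [res_subst]
    exact mul_ne_zero (pow_ne_zero 4 h.det_ne_zero) hq
  have h_inv : (h⁻¹ : GL (Fin 2) F).val = (det h.val)⁻¹ • adjugate h.val := by
    rw [coe_units_inv, inv_def, Ring.inverse_eq_inv']
  rw [conjBy, ratComp_toRat_mobius hq, ratComp_mobius, ← toRat_comb (den_ne_zero h_subst), h_inv,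
    comb_smul, toRat_smul (inv_ne_zero h.det_ne_zero), act]

theorem isConj_toRat_iff {q q' : QuadPair F} (hq : q.res ≠ 0) :
    IsConj q.toRat q'.toRat ↔ Rel q q' := by
  constructor
  · rintro ⟨h, hh⟩
    rw [conjBy_toRat hq] at hh
    have h_act : (q.act h).res ≠ 0 := (q.rel_act h.det_ne_zero).res_ne_zero hq
    have hq' : q'.res ≠ 0 := res_ne_zero_of_ratDegree (hh ▸ ratDegree_toRat h_act)
    obtain ⟨w, hw, rfl⟩ := exists_smul_eq_of_toRat_eq h_act hq' hh
    exact ⟨h, w, h.det_ne_zero, hw, rfl⟩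
  · rintro ⟨g, w, hg, hw, rfl⟩
    exact ⟨.mkOfDetNeZero g hg, (conjBy_toRat hq _).trans (toRat_smul hw _).symm⟩

/-- The image of a pair of forms under a ring homomorphism of the coefficients. -/
def map {E : Type*} [Field E] (i : F →+* E) (q : QuadPair F) : QuadPair E :=
  ⟨i q.a, i q.b, i q.c, i q.d, i q.e, i q.f⟩

theorem res_map {E : Type*} [Field E] (i : F →+* E) (q : QuadPair F) :
    (q.map i).res = i q.res := by
  simp [res, map]

theorem res_map_ne_zero {E : Type*} [Field E] (i : F →+* E) {q : QuadPair F} (hq : q.res ≠ 0) :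
    (q.map i).res ≠ 0 := by
  simpa [res_map] using hq

theorem toBar_toRat (q : QuadPair F) :
    toBar q.toRat = (q.map (algebraMap F (AlgebraicClosure F))).toRat := by
  rw [toRat, toBar, RatFunc.coe_mapRingHom_eq_coe_map, RatFunc.map_apply_div, toRat]
  simp [num, den, map]

theorem toRat_ofA (s t : F) : (ofA s t).toRat = formA s t := by
  simp [toRat, num, den, ofA, formA, map_ofNat (RatFunc.C : F →+* RatFunc F) 2]

theorem toRat_ofB (k b : F) : (ofB k b).toRat = formB k b := by
  simp only [toRat, num, den, ofB, formB, map_add, map_mul, map_pow, RatFunc.algebraMap_C,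
    RatFunc.algebraMap_X, map_zero, map_one, zero_mul, zero_add, add_zero, one_mul]
  field_simp

theorem toRat_ofC (d k : F) : (ofC d k).toRat = formC d k := by
  simp [toRat, num, den, ofC, formC, sub_eq_add_neg]

theorem map_ofA {E : Type*} [Field E] (i : F →+* E) (s t : F) :
    (ofA s t).map i = ofA (i s) (i t) := by
  simp [map, ofA, map_ofNat i 2]

theorem map_ofB {E : Type*} [Field E] (i : F →+* E) (k b : F) :
    (ofB k b).map i = ofB (i k) (i b) := by
  simp [map, ofB]

theorem map_ofC {E : Type*} [Field E] (i : F →+* E) (d k : F) :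
    (ofC d k).map i = ofC (i d) (i k) := by
  simp [map, ofC, map_ofNat i 2]

theorem res_ofB (k b : F) : (ofB k b).res = k * b := by
  simp [res, ofB]

theorem res_ofC (d k : F) : (ofC d k).res = 4 * d * (d - k ^ 2) ^ 2 := by
  simp only [res, ofC]
  ring

theorem res_ofB_ne_zero {k b : F} (hk : k ≠ 0) (hb : b ≠ 0) : (ofB k b).res ≠ 0 := by
  rw [res_ofB]
  exact mul_ne_zero hk hb

theorem res_ofC_ne_zero (h2 : (2 : F) ≠ 0) {d k : F} (hd : d ≠ 0) (hk : k ^ 2 ≠ d) :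
    (ofC d k).res ≠ 0 := by
  have h4 : (4 : F) ≠ 0 := by
    convert mul_ne_zero h2 h2 using 1
    norm_num
  rw [res_ofC]
  exact mul_ne_zero (mul_ne_zero h4 hd) (pow_ne_zero 2 (sub_ne_zero.2 hk.symm))

/-- The determinant of two vectors of the plane, which vanishes when they represent the same
projective point. -/
def wedge (u v : Fin 2 → F) : F := u 0 * v 1 - u 1 * v 0

theorem wedge_adjugate_mulVec (g : Matrix (Fin 2) (Fin 2) F) (u v : Fin 2 → F) :
    wedge (g.adjugate *ᵥ u) v = wedge u (g *ᵥ v) := by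
  simp only [wedge, adjugate_fin_two, mulVec, dotProduct, Fin.sum_univ_two, of_apply, cons_val]
  ring

theorem wedge_comm (u v : Fin 2 → F) : wedge u v = -wedge v u := by
  simp only [wedge]
  ring

/-- The vector `v` represents a fixed point of multiplier `l` of the lifted rational map. If
`q.eval v = μ • v`, then one eigenvalue of the differential of the lift at `v` is `2 * μ`, by
Euler's identity, and the other is `l * μ`; the trace of the differential is the divergence. -/
def IsFixed (q : QuadPair F) (v : Fin 2 → F) (l : F) : Prop :=
  v ≠ 0 ∧ ∃ μ, q.eval v = μ • v ∧ q.divergence v = (2 + l) * μ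

theorem IsFixed.smul {q : QuadPair F} {v : Fin 2 → F} {l : F} (h : q.IsFixed v l) (w : F) :
    (w • q).IsFixed v l := by
  obtain ⟨hv, μ, h_eval, h_div⟩ := h
  refine ⟨hv, w * μ, ?_, ?_⟩
  · rw [smul_eval, h_eval, mul_smul]
  · rw [smul_divergence, h_div]
    ring

theorem divergence_smul (q : QuadPair F) (t : F) (u : Fin 2 → F) :
    q.divergence (t • u) = t * q.divergence u := by
  simp only [divergence, Pi.smul_apply, smul_eq_mul]
  ring

theorem IsFixed.smul_vector {q : QuadPair F} {v : Fin 2 → F} {l t : F} (h : q.IsFixed v l)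
    (ht : t ≠ 0) : q.IsFixed (t • v) l := by
  obtain ⟨hv, μ, h_eval, h_div⟩ := h
  refine ⟨smul_ne_zero ht hv, t * μ, ?_, ?_⟩
  · rw [eval_smul, h_eval, smul_smul, smul_smul]
    ring_nf
  · rw [divergence_smul, h_div]
    ring

theorem IsFixed.act {q : QuadPair F} {v : Fin 2 → F} {l : F} (h : q.IsFixed v l)
    {g : Matrix (Fin 2) (Fin 2) F} (hg : g.det ≠ 0) : (q.act g).IsFixed (g.adjugate *ᵥ v) l := by
  obtain ⟨hv, μ, h_eval, h_div⟩ := h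
  have h_cancel : g *ᵥ g.adjugate *ᵥ v = g.det • v := by
    rw [mulVec_mulVec, mul_adjugate, smul_mulVec, one_mulVec]
  refine ⟨?_, g.det ^ 2 * μ, ?_, ?_⟩
  · intro h0
    rw [h0, mulVec_zero] at h_cancel
    exact smul_ne_zero hg hv h_cancel.symm
  · rw [eval_act, h_cancel, eval_smul, h_eval, mulVec_smul, mulVec_smul, mul_smul]
  · rw [divergence_act, h_cancel, divergence_smul, h_div]
    ring

/-- The vectors `v i` represent the fixed points, counted with multiplicity, of the lifted rational
map, and the `l i` are their multipliers. -/
structure HasFixedPoints (q : QuadPair F) (v : Fin 3 → Fin 2 → F) (l : Fin 3 → F) : Prop where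
  exists_wedge_eval : ∃ κ ≠ 0, ∀ u, wedge (q.eval u) u = κ * ∏ i, wedge u (v i)
  isFixed : ∀ i, q.IsFixed (v i) (l i)

theorem HasFixedPoints.smul {q : QuadPair F} {v : Fin 3 → Fin 2 → F} {l : Fin 3 → F}
    (h : q.HasFixedPoints v l) {w : F} (hw : w ≠ 0) : (w • q).HasFixedPoints v l := by
  obtain ⟨⟨κ, hκ, h_wedge⟩, h_fixed⟩ := h
  refine ⟨⟨w * κ, mul_ne_zero hw hκ, fun u ↦ ?_⟩, fun i ↦ (h_fixed i).smul w⟩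
  rw [mul_assoc, ← h_wedge, smul_eval]
  simp only [wedge, Pi.smul_apply, smul_eq_mul]
  ring

theorem HasFixedPoints.act {q : QuadPair F} {v : Fin 3 → Fin 2 → F} {l : Fin 3 → F}
    (h : q.HasFixedPoints v l) {g : Matrix (Fin 2) (Fin 2) F} (hg : g.det ≠ 0) :
    (q.act g).HasFixedPoints (fun i ↦ g.adjugate *ᵥ v i) l := by
  obtain ⟨⟨κ, hκ, h_wedge⟩, h_fixed⟩ := h
  refine ⟨⟨κ, hκ, fun u ↦ ?_⟩, fun i ↦ (h_fixed i).act hg⟩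
  have h_factor (i) : wedge u (g.adjugate *ᵥ v i) = wedge (g *ᵥ u) (v i) := by
    rw [wedge_comm, wedge_adjugate_mulVec, wedge_comm, neg_neg]
  simp only [eval_act, wedge_adjugate_mulVec, h_factor, h_wedge]

theorem HasFixedPoints.exists_of_rel {q q' : QuadPair F} {v : Fin 3 → Fin 2 → F} {l : Fin 3 → F}
    (h : q.HasFixedPoints v l) (hq : Rel q q') : ∃ v', q'.HasFixedPoints v' l := by
  obtain ⟨g, w, hg, hw, rfl⟩ := hq
  exact ⟨_, (h.act hg).smul hw⟩

theorem eval_ne_zero {q : QuadPair F} (hq : q.res ≠ 0) {v : Fin 2 → F} (hv : v ≠ 0) :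
    q.eval v ≠ 0 := by
  contrapose! hv
  have h0 : q.a * v 0 ^ 2 + q.b * v 0 * v 1 + q.c * v 1 ^ 2 = 0 := congrFun hv 0
  have h1 : q.d * v 0 ^ 2 + q.e * v 0 * v 1 + q.f * v 1 ^ 2 = 0 := congrFun hv 1
  have hx : q.res * v 0 ^ 3 = 0 := by
    rw [res]
    linear_combination (q.a * q.f - q.c * q.d) * v 0 * (q.f * h0 - q.c * h1) -
      (q.b * q.f - q.c * q.e) *
        (v 0 * (q.e * h0 - q.b * h1) + v 1 * (q.f * h0 - q.c * h1))
  have hy : q.res * v 1 ^ 3 = 0 := by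
    rw [res]
    linear_combination (q.a * q.f - q.c * q.d) * v 1 * (q.a * h1 - q.d * h0) -
      (q.a * q.e - q.b * q.d) *
        (v 0 * (q.a * h1 - q.d * h0) - v 1 * (q.e * h0 - q.b * h1))
  ext i
  fin_cases i
  · simpa [hq] using hx
  · simpa [hq] using hy

theorem derivAt_toRat {q : QuadPair F} (hq : q.res ≠ 0) {z l : F} (h : q.IsFixed ![z, 1] l) :
    derivAt q.toRat z = l := by
  obtain ⟨hv, μ, h_eval, h_div⟩ := h
  have hμ : μ ≠ 0 := by
    rintro rfl
    exact eval_ne_zero hq hv (by rw [h_eval, zero_smul])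
  have h_num : q.num.eval z = μ * z := by simpa [QuadPair.eval, num] using congrFun h_eval 0
  have h_den : q.den.eval z = μ := by simpa [QuadPair.eval, den] using congrFun h_eval 1
  have hc := inv_leadingCoeff_den_ne_zero hq
  have h_div' : (2 * q.a + q.e) * z + (q.b + 2 * q.f) = (2 + l) * μ := by
    simpa [divergence] using h_div
  rw [derivAt, num_toRat hq, denom_toRat hq]
  simp only [derivative_C_mul, eval_sub, eval_mul, eval_C, h_num, h_den]
  rw [div_eq_iff (by positivity)]
  have h_num' : q.num.derivative.eval z = 2 * q.a * z + q.b := by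
    simp only [num, derivative_add, derivative_C_mul, derivative_X_sq, derivative_X,
      derivative_C, eval_add, eval_mul, eval_C, eval_X, eval_one, eval_zero]
    ring
  have h_den' : q.den.derivative.eval z = 2 * q.d * z + q.e := by
    simp only [den, derivative_add, derivative_C_mul, derivative_X_sq, derivative_X,
      derivative_C, eval_add, eval_mul, eval_C, eval_X, eval_one, eval_zero]
    ring
  have h_den'' : q.d * z ^ 2 + q.e * z + q.f = μ := by simpa [den] using h_den
  rw [h_num', h_den']
  linear_combination q.den.leadingCoeff⁻¹ ^ 2 * μ * (h_div' - 2 * h_den'')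

theorem atInfty_toRat {q : QuadPair F} (hq : q.res ≠ 0) :
    atInfty q.toRat = (q.act !![0, -1; -1, 0]).toRat := by
  have hX : (RatFunc.X : RatFunc F) ≠ 0 := RatFunc.X_ne_zero
  have h_eval (a b c : F) : (C a * X ^ 2 + C b * X + C c).eval₂ RatFunc.C (RatFunc.X)⁻¹ =
      algebraMap F[X] (RatFunc F) (C c * X ^ 2 + C b * X + C a) / RatFunc.X ^ 2 := by
    rw [← one_div, eval₂_quadratic_div hX]
    simp only [map_add, map_mul, map_pow, RatFunc.algebraMap_C, RatFunc.algebraMap_X]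
    ring
  rw [atInfty, toRat, ratComp_div (isCoprime_num_den hq) (den_ne_zero hq), num, den, h_eval,
    h_eval, div_div_div_cancel_right₀ (pow_ne_zero 2 hX), inv_div, act_swap, toRat, num, den]

theorem roots_fixedPoly_toRat [Infinite F] {q : QuadPair F} (hq : q.res ≠ 0)
    {v : Fin 3 → Fin 2 → F} {l : Fin 3 → F} (h : q.HasFixedPoints v l) :
    (fixedPoly q.toRat).roots = ∑ i, (C (v i 1) * X - C (v i 0)).roots := by
  obtain ⟨⟨κ, hκ, h_wedge⟩, h_fixed⟩ := h
  have h_ne (i) : C (v i 1) * X - C (v i 0) ≠ 0 := by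
    intro h0
    rw [sub_eq_add_neg, ← C_neg, linear_eq_zero_iff, neg_eq_zero] at h0
    refine (h_fixed i).1 (funext fun j ↦ ?_)
    fin_cases j
    exacts [h0.2, h0.1]
  have h_eq : fixedPoly q.toRat =
      C (q.den.leadingCoeff⁻¹ * κ) * ∏ i, (C (v i 1) * X - C (v i 0)) := by
    refine Polynomial.funext fun z ↦ ?_
    have h_num : q.num.eval z = (q.eval ![z, 1]) 0 := by simp [num, QuadPair.eval]
    have h_den : q.den.eval z = (q.eval ![z, 1]) 1 := by simp [den, QuadPair.eval]
    have h_factor (i) : (C (v i 1) * X - C (v i 0)).eval z = wedge ![z, 1] (v i) := by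
      simp [wedge, mul_comm z]
    rw [fixedPoly, num_toRat hq, denom_toRat hq, eval_mul, eval_C, eval_prod, mul_assoc]
    simp only [h_factor]
    rw [← h_wedge]
    simp only [eval_sub, eval_mul, eval_C, eval_X, h_num, h_den, wedge, cons_val_zero, cons_val_one]
    ring
  rw [h_eq, roots_C_mul _ (mul_ne_zero (inv_leadingCoeff_den_ne_zero hq) hκ), Fin.prod_univ_three,
    roots_mul (by simp [h_ne]), roots_mul (by simp [h_ne]), Fin.sum_univ_three]

theorem IsFixed.map_derivAt_add_replicate [DecidableEq F] {q : QuadPair F} (hq : q.res ≠ 0)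
    {v : Fin 2 → F} {l : F} (h : q.IsFixed v l) :
    (C (v 1) * X - C (v 0)).roots.map (derivAt q.toRat) +
      Multiset.replicate ((C (v 0) * X - C (v 1)).roots.count 0)
        (derivAt (q.act !![0, -1; -1, 0]).toRat 0) = {l} := by
  have h_swap : (q.act !![0, -1; -1, 0]).IsFixed ![v 1, v 0] l := by
    convert h.act (g := !![0, -1; -1, 0]) (by simp) using 1
    ext i
    fin_cases i <;> simp [adjugate_fin_two, mulVec, dotProduct]
  by_cases h1 : v 1 = 0
  · have h0 : v 0 ≠ 0 := by
      intro h0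
      refine h.1 (funext fun j ↦ ?_)
      fin_cases j
      exacts [h0, h1]
    have h_deriv : derivAt (q.act !![0, -1; -1, 0]).toRat 0 = l := by
      refine derivAt_toRat ((q.rel_act (by simp)).res_ne_zero hq) ?_
      convert h_swap.smul_vector (inv_ne_zero h0) using 1
      simp [h0, h1]
    rw [h_deriv, roots_C_mul_X_sub_C _ h0]
    simp [h1]
  · have h_deriv : derivAt q.toRat ((v 1)⁻¹ * v 0) = l := by
      refine derivAt_toRat hq ?_
      convert h.smul_vector (inv_ne_zero h1) using 1
      ext i
      fin_cases i <;> simp [h1]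
    rw [roots_C_mul_X_sub_C _ h1, count_roots, rootMultiplicity_eq_zero (by simpa using h1)]
    simp [h_deriv]

theorem HasFixedPoints.multipliers_toRat [Infinite F] {q : QuadPair F} (hq : q.res ≠ 0)
    {v : Fin 3 → Fin 2 → F} {l : Fin 3 → F} (h : q.HasFixedPoints v l) :
    multipliers q.toRat = {l 0, l 1, l 2} := by
  classical
  have hJ : det !![(0 : F), -1; -1, 0] ≠ 0 := by simp
  have h_swap (i) : C ((adjugate !![0, -1; -1, 0] *ᵥ v i) 1) * X -
      C ((adjugate !![0, -1; -1, 0] *ᵥ v i) 0) = C (v i 0) * X - C (v i 1) := by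
    simp [adjugate_fin_two, mulVec, dotProduct]
  have h_fixed (i) := (h.isFixed i).map_derivAt_add_replicate hq
  calc multipliers q.toRat = ∑ i, {l i} := by
        rw [multipliers, atInfty_toRat hq, ← count_roots, roots_fixedPoly_toRat hq h,
          roots_fixedPoly_toRat ((q.rel_act hJ).res_ne_zero hq) (h.act hJ)]
        simp only [h_swap, ← h_fixed, Fin.sum_univ_three, Multiset.map_add, Multiset.count_add,
          Multiset.replicate_add]
        abel
    _ = {l 0, l 1, l 2} := by
        rw [Fin.sum_univ_three]
        rfl

end QuadPair

theorem condA_iff_eq_one {l₁ l₂ l₃ : F} : CondA l₁ l₂ l₃ ↔ (l₁ = l₂ → l₁ = 1) ∧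
    (l₁ = l₃ → l₁ = 1) ∧ (l₂ = l₃ → l₂ = 1) ∧ ¬(l₁ = 1 ∧ l₂ = 1 ∧ l₃ = 1) := by
  grind [CondA]

theorem condA_iff_count_le [DecidableEq F] {l₁ l₂ l₃ : F} : CondA l₁ l₂ l₃ ↔
    ∀ x, ({l₁, l₂, l₃} : Multiset F).count x ≤ if x = 1 then 2 else 1 := by
  simp only [Multiset.insert_eq_cons, Multiset.count_cons, Multiset.count_singleton]
  constructor
  · grind [CondA]
  · intro h
    have h1 := h l₁
    have h2 := h l₂
    grind [CondA]

theorem CondA.congr {l₁ l₂ l₃ m₁ m₂ m₃ : F} (h : ({l₁, l₂, l₃} : Multiset F) = {m₁, m₂, m₃})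
    (hl : CondA l₁ l₂ l₃) : CondA m₁ m₂ m₃ := by
  classical
  rwa [condA_iff_count_le, ← h, ← condA_iff_count_le]

theorem CondC.congr {l₁ l₂ l₃ m₁ m₂ m₃ : F} (h : ({l₁, l₂, l₃} : Multiset F) = {m₁, m₂, m₃})
    (hl : CondC l₁ l₂ l₃) : CondC m₁ m₂ m₃ := by
  obtain ⟨rfl, rfl, rfl⟩ := hl
  have h_mem (x) (hx : x ∈ ({m₁, m₂, m₃} : Multiset F)) : x = -2 := by
    rw [← h] at hx
    simpa using hx
  exact ⟨h_mem _ (by simp), h_mem _ (by simp), h_mem _ (by simp)⟩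

theorem eq_of_pair_eq {α : Type*} {x y x' y' : α}
    (h : ({x, x, y} : Multiset α) = {x', x', y'}) : x = x' := by
  classical
  by_contra hx
  have h_count := congrArg (Multiset.count x) h
  simp only [Multiset.insert_eq_cons, Multiset.count_cons, Multiset.count_singleton] at h_count
  grind

theorem sum_prod_eq_of_multiset_eq {l₁ l₂ l₃ m₁ m₂ m₃ : F}
    (h : ({l₁, l₂, l₃} : Multiset F) = {m₁, m₂, m₃}) : l₁ + l₂ + l₃ = m₁ + m₂ + m₃ ∧
      l₁ * l₂ + l₁ * l₃ + l₂ * l₃ = m₁ * m₂ + m₁ * m₃ + m₂ * m₃ := by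
  have h_sum := congrArg Multiset.sum h
  have h_prod := congrArg Multiset.prod h
  have h_prod_add_one := congrArg (fun s ↦ (s.map (· + 1)).prod) h
  simp only [Multiset.insert_eq_cons, Multiset.map_cons, Multiset.map_singleton, Multiset.sum_cons,
    Multiset.sum_singleton, Multiset.prod_cons, Multiset.prod_singleton]
    at h_sum h_prod h_prod_add_one
  constructor
  · linear_combination h_sum
  · linear_combination h_prod_add_one - h_prod - h_sum

namespace QuadPair

theorem isFixed_of_wedge_eq_zero {q : QuadPair F} {z l : F}
    (h : wedge (q.eval ![z, 1]) ![z, 1] = 0)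
    (hl : q.divergence ![z, 1] = (2 + l) * q.eval ![z, 1] 1) : q.IsFixed ![z, 1] l := by
  refine ⟨fun h0 ↦ one_ne_zero (congrFun h0 1), _, ?_, hl⟩
  ext i
  fin_cases i
  · simpa [wedge, sub_eq_zero] using h
  · simp

theorem hasFixedPoints_of_wedge_eval {q : QuadPair F} (hd : q.d ≠ 0) {z l : Fin 3 → F}
    (h : ∀ u, wedge (q.eval u) u = -q.d * ∏ i, wedge u ![z i, 1])
    (hl : ∀ i, q.divergence ![z i, 1] = (2 + l i) * q.eval ![z i, 1] 1) :
    q.HasFixedPoints (fun i ↦ ![z i, 1]) l := by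
  refine ⟨⟨_, neg_ne_zero.2 hd, h⟩, fun i ↦ isFixed_of_wedge_eq_zero ?_ (hl i)⟩
  rw [h, Finset.prod_eq_zero (Finset.mem_univ i) (by simp [wedge]), mul_zero]

theorem exists_sum_prod_eq [IsAlgClosed F] (s t p : F) : ∃ l : Fin 3 → F,
    l 0 + l 1 + l 2 = s ∧ l 0 * l 1 + l 0 * l 2 + l 1 * l 2 = t ∧ l 0 * l 1 * l 2 = p := by
  let P : Cubic F := ⟨1, -s, t, -p⟩
  have ha : P.a ≠ 0 := one_ne_zero
  obtain ⟨x, y, z, h⟩ :=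
    (Cubic.splits_iff_roots_eq_three (φ := RingHom.id F) ha).1 (IsAlgClosed.splits _)
  have hb := Cubic.b_eq_three_roots ha h
  have hc := Cubic.c_eq_three_roots ha h
  have hd := Cubic.d_eq_three_roots ha h
  simp only [P, RingHom.id_apply] at hb hc hd
  refine ⟨![x, y, z], ?_, ?_, ?_⟩ <;> simp only [cons_val]
  · linear_combination hb
  · linear_combination -hc
  · linear_combination hd

theorem hasFixedPoints_ofA {s t : F} {l : Fin 3 → F} (hs : l 0 + l 1 + l 2 = s)
    (ht : l 0 * l 1 + l 0 * l 2 + l 1 * l 2 = t) (hp : l 0 * l 1 * l 2 = s - 2) :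
    (ofA s t).HasFixedPoints (fun i ↦ ![l i, 1]) l := by
  have h_wedge (u : Fin 2 → F) :
      wedge ((ofA s t).eval u) u = -(ofA s t).d * ∏ i, wedge u ![l i, 1] := by
    simp only [wedge, QuadPair.eval, ofA, Fin.prod_univ_three, cons_val_zero, cons_val_one]
    linear_combination u 0 ^ 2 * u 1 * hs - u 0 * u 1 ^ 2 * ht + u 1 ^ 3 * hp
  refine hasFixedPoints_of_wedge_eval (by simp [ofA]) h_wedge fun i ↦ ?_
  have h_root := h_wedge ![l i, 1]
  rw [Finset.prod_eq_zero (Finset.mem_univ i) (by simp [wedge]), mul_zero] at h_root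
  simp only [wedge, QuadPair.eval, ofA, divergence, cons_val_zero, cons_val_one] at h_root ⊢
  linear_combination h_root

theorem condA_of_hasFixedPoints_ofA {s t : F} (hr : (ofA s t).res ≠ 0) {l : Fin 3 → F}
    (hs : l 0 + l 1 + l 2 = s) (ht : l 0 * l 1 + l 0 * l 2 + l 1 * l 2 = t)
    (hp : l 0 * l 1 * l 2 = s - 2) : CondA (l 0) (l 1) (l 2) := by
  have h_denom (i) : -l i ^ 2 + (2 + s) * l i + (2 - s - t) ≠ 0 := by
    obtain ⟨hv, μ, h_eval, -⟩ := (hasFixedPoints_ofA hs ht hp).isFixed i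
    have hμ : -l i ^ 2 + (2 + s) * l i + (2 - s - t) = μ := by
      simpa [QuadPair.eval, ofA] using congrFun h_eval 1
    rintro h0
    refine eval_ne_zero hr hv ?_
    rw [h_eval, ← hμ, h0, zero_smul]
  have h_deriv₀ : (l 0 - 1) * (-l 0 ^ 2 + (2 + s) * l 0 + (2 - s - t)) =
      (l 0 - l 1) * (l 0 - l 2) := by
    subst hs ht
    linear_combination -hp
  have h_deriv₁ : (l 1 - 1) * (-l 1 ^ 2 + (2 + s) * l 1 + (2 - s - t)) =
      (l 1 - l 0) * (l 1 - l 2) := by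
    subst hs ht
    linear_combination -hp
  have h_ne : ¬(l 0 = 1 ∧ l 1 = 1 ∧ l 2 = 1) := by
    rintro ⟨h0, h1, h2⟩
    refine h_denom 0 ?_
    simp only [h0, h1, h2] at hs ht ⊢
    linear_combination ht
  have h01 (h : l 0 = l 1) : l 0 = 1 := by simpa [← h, h_denom, sub_eq_zero] using h_deriv₀
  have h02 (h : l 0 = l 2) : l 0 = 1 := by simpa [← h, h_denom, sub_eq_zero] using h_deriv₀
  have h12 (h : l 1 = l 2) : l 1 = 1 := by simpa [← h, h_denom, sub_eq_zero] using h_deriv₁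
  exact condA_iff_eq_one.2 ⟨h01, h02, h12, h_ne⟩

theorem exists_hasFixedPoints_ofA [IsAlgClosed F] {s t : F} (hr : (ofA s t).res ≠ 0) :
    ∃ v, ∃ l : Fin 3 → F, l 0 + l 1 + l 2 = s ∧ l 0 * l 1 + l 0 * l 2 + l 1 * l 2 = t ∧
      CondA (l 0) (l 1) (l 2) ∧ (ofA s t).HasFixedPoints v l := by
  obtain ⟨l, hs, ht, hp⟩ := exists_sum_prod_eq s t (s - 2)
  exact ⟨_, l, hs, ht, condA_of_hasFixedPoints_ofA hr hs ht hp, hasFixedPoints_ofA hs ht hp⟩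

theorem exists_hasFixedPoints_ofB [IsAlgClosed F] {k b : F} (hk : k ≠ 0) (hb : b ≠ 0) :
    ∃ v, (ofB k b).HasFixedPoints v ![2 * k - 1, 2 * k - 1, 1 / k] := by
  obtain ⟨r, hr⟩ := IsAlgClosed.exists_pow_nat_eq ((1 - k) / b) two_pos
  have hr' : b * r ^ 2 = 1 - k := by rw [hr, mul_div_cancel₀ _ hb]
  have h_finite {x : F} (hx : x ^ 2 = r ^ 2) : (ofB k b).IsFixed ![1, x] (2 * k - 1) := by
    refine ⟨fun h ↦ one_ne_zero (congrFun h 0), 1, ?_, ?_⟩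
    · have h_eval : k + b * x ^ 2 = 1 := by
        linear_combination b * hx + hr'
      simp [QuadPair.eval, ofB, h_eval]
    · simp only [divergence, ofB, cons_val]
      ring
  have h_infty : (ofB k b).IsFixed ![1, 0] (1 / k) := by
    refine ⟨fun h ↦ one_ne_zero (congrFun h 0), k, ?_, ?_⟩
    · simp [QuadPair.eval, ofB]
    · simp only [divergence, ofB, cons_val]
      field_simp
      ring
  refine ⟨![![1, r], ![1, -r], ![1, 0]], ⟨-b, neg_ne_zero.2 hb, fun u ↦ ?_⟩, fun i ↦ ?_⟩
  · simp only [wedge, QuadPair.eval, ofB, Fin.prod_univ_three, cons_val]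
    linear_combination u 0 ^ 2 * u 1 * hr'
  · fin_cases i
    exacts [h_finite rfl, h_finite (neg_sq r), h_infty]

theorem exists_hasFixedPoints_ofC [IsAlgClosed F] (d k : F) :
    ∃ v, (ofC d k).HasFixedPoints v ![-2, -2, -2] := by
  obtain ⟨z, hs, ht, hp⟩ := exists_sum_prod_eq (3 * k) (3 * d) (d * k)
  refine ⟨_, hasFixedPoints_of_wedge_eval (z := z) (by simp [ofC]) (fun u ↦ ?_) fun i ↦ ?_⟩
  · simp only [wedge, QuadPair.eval, ofC, Fin.prod_univ_three, cons_val_zero, cons_val_one]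
    linear_combination u 0 * u 1 ^ 2 * ht - u 0 ^ 2 * u 1 * hs - u 1 ^ 3 * hp
  · fin_cases i <;> simp [divergence, ofC]

theorem Rel.multiset_eq [Infinite F] {q q' : QuadPair F} (hq : q.res ≠ 0) (h : Rel q q')
    {v v' : Fin 3 → Fin 2 → F} {l l' : Fin 3 → F} (hl : q.HasFixedPoints v l)
    (hl' : q'.HasFixedPoints v' l') : ({l 0, l 1, l 2} : Multiset F) = {l' 0, l' 1, l' 2} := by
  obtain ⟨v'', hl⟩ := hl.exists_of_rel h
  rw [← hl.multipliers_toRat (h.res_ne_zero hq), hl'.multipliers_toRat (h.res_ne_zero hq)]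

theorem Rel.ofA_inj [IsAlgClosed F] {s t s' t' : F} (hr : (ofA s t).res ≠ 0)
    (h : Rel (ofA s t) (ofA s' t')) : s = s' ∧ t = t' := by
  obtain ⟨v, l, rfl, rfl, -, hl⟩ := exists_hasFixedPoints_ofA hr
  obtain ⟨v', l', rfl, rfl, -, hl'⟩ := exists_hasFixedPoints_ofA (h.res_ne_zero hr)
  exact sum_prod_eq_of_multiset_eq (h.multiset_eq hr hl hl')

theorem Rel.ofB_fst_eq [IsAlgClosed F] (h2 : (2 : F) ≠ 0) {k b k' b' : F} (hk : k ≠ 0)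
    (hb : b ≠ 0) (hk' : k' ≠ 0) (hb' : b' ≠ 0) (h : Rel (ofB k b) (ofB k' b')) : k = k' := by
  obtain ⟨v, hl⟩ := exists_hasFixedPoints_ofB hk hb
  obtain ⟨v', hl'⟩ := exists_hasFixedPoints_ofB hk' hb'
  have h_eq := eq_of_pair_eq (h.multiset_eq (res_ofB_ne_zero hk hb) hl hl')
  exact mul_left_cancel₀ h2 (sub_left_inj.1 h_eq)

theorem rel_ofB_of_div_eq_sq {k b b' c : F} (hb' : b' ≠ 0) (hc : c ≠ 0) (h : b / b' = c ^ 2) :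
    Rel (ofB k b) (ofB k b') := by
  rw [div_eq_iff hb'] at h
  subst h
  refine ⟨!![c, 0; 0, 1], 1 / c ^ 2, by simpa using hc, by simpa using hc, ?_⟩
  simp only [ofB, act, subst, comb, smul_def, adjugate_fin_two_of, of_apply, cons_val]
  ext <;> field_simp <;> ring

theorem Rel.ofB_exists_div_eq_sq {k b b' : F} (hk : 2 * k + 1 ≠ 0) (hb' : b' ≠ 0)
    (h : Rel (ofB k b) (ofB k b')) : ∃ c, c ≠ 0 ∧ b / b' = c ^ 2 := by
  obtain ⟨g, w, hg, hw, h⟩ := h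
  have h_div (u : Fin 2 → F) : u 0 = w * g.det * (g *ᵥ u) 0 := by
    have h_div := congrArg (·.divergence u) h
    simp only [smul_divergence, divergence_act] at h_div
    refine mul_left_cancel₀ hk ?_
    simpa [divergence, ofB, mul_assoc, mul_comm, mul_left_comm] using h_div
  have h_upper : g 0 1 = 0 := by
    simpa [hw, hg, mulVec, dotProduct] using h_div ![0, 1]
  have h_det : g.det = g 0 0 * g 1 1 := by
    rw [det_fin_two, h_upper, zero_mul, sub_zero]
  have h_one : 1 = w * g.det * g 0 0 := by
    simpa [mulVec, dotProduct] using h_div ![1, 0]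
  have hb_eq : b' = w * (g 1 1 * (b * g 1 1 ^ 2)) := by
    have h_c := congrArg QuadPair.c h
    simpa [ofB, act, subst, comb, smul_def, adjugate_fin_two, h_upper] using h_c
  rw [h_det] at hg h_one
  obtain ⟨hα, hδ⟩ := mul_ne_zero_iff.1 hg
  refine ⟨g 0 0 / g 1 1, div_ne_zero hα hδ, ?_⟩
  rw [div_pow, div_eq_div_iff hb' (pow_ne_zero 2 hδ)]
  linear_combination b * g 1 1 ^ 2 * h_one - g 0 0 ^ 2 * hb_eq

theorem rel_ofC_inv_sq [IsAlgClosed F] (h2 : (2 : F) ≠ 0) {d k : F} (hd : d ≠ 0) (hk : k ^ 2 ≠ d) :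
    Rel (ofC d k) ⟨0, 0, 1, 1, 0, 0⟩ := by
  obtain ⟨e, rfl⟩ := IsAlgClosed.exists_pow_nat_eq d two_pos
  have he : e ≠ 0 := by
    rintro rfl
    simp at hd
  have h4 : (4 : F) ≠ 0 := by
    convert mul_ne_zero h2 h2 using 1
    norm_num
  have hp : k + e ≠ 0 := fun h ↦ hk (by linear_combination (k - e) * h)
  have hm : e - k ≠ 0 := fun h ↦ hk (by linear_combination (-k - e) * h)
  have h_diag : Rel (ofC (e ^ 2) k) ⟨0, 0, k + e, e - k, 0, 0⟩ := by
    refine ⟨!![e, -e; 1, 1], (4 * e ^ 2)⁻¹, ?_, ?_, ?_⟩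
    · simpa [det_fin_two_of, ← two_mul, he] using h2
    · positivity
    · simp only [ofC, act, subst, comb, smul_def, adjugate_fin_two_of, of_apply, cons_val]
      ext <;> field_simp <;> ring
  obtain ⟨u, hu⟩ := IsAlgClosed.exists_pow_nat_eq ((k + e) / (e - k)) three_pos
  have hu' : u ^ 3 * (e - k) = k + e := by rw [hu, div_mul_cancel₀ _ hm]
  have hu0 : u ≠ 0 := by
    rintro rfl
    simp [hp.symm] at hu'
  refine h_diag.trans ⟨!![u, 0; 0, 1], (k + e)⁻¹, by simpa using hu0, inv_ne_zero hp, ?_⟩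
  simp only [act, subst, comb, smul_def, adjugate_fin_two_of, of_apply, cons_val]
  ext <;> field_simp <;> first | ring1 | linear_combination -hu'

theorem jacobian_ofC (d k : F) (u v : Fin 2 → F) :
    (ofC d k).jacobian u v = 2 * (d - k ^ 2) * (u 0 * v 0 - d * (u 1 * v 1)) := by
  simp only [jacobian, ofC]
  ring

-- The Jacobian of `ofC d k` is proportional to `x ^ 2 - d * y ^ 2`, and a conjugation carries one
-- Jacobian to a multiple of the other.
theorem quadratic_form_of_ofC_eq_act (h2 : (2 : F) ≠ 0) {d k d' k' α β γ δ w : F} (hk : k ^ 2 ≠ d)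
    (hg : α * δ - β * γ ≠ 0) (hw : w ≠ 0) (h : ofC d' k' = w • (ofC d k).act !![α, β; γ, δ]) :
    α * β = d * (γ * δ) ∧ d' * (α ^ 2 - d * γ ^ 2) = d * δ ^ 2 - β ^ 2 := by
  have h_ne : w ^ 2 * (α * δ - β * γ) ^ 2 * (2 * (d - k ^ 2)) ≠ 0 := by
    have := sub_ne_zero.2 hk.symm
    positivity
  have h_jac (u v : Fin 2 → F) : 2 * (d' - k' ^ 2) * (u 0 * v 0 - d' * (u 1 * v 1)) =
      w ^ 2 * (α * δ - β * γ) ^ 2 * (2 * (d - k ^ 2)) * ((α * u 0 + β * u 1) * (α * v 0 + β * v 1) -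
        d * ((γ * u 0 + δ * u 1) * (γ * v 0 + δ * v 1))) := by
    have h_jac := congrArg (·.jacobian u v) h
    simp only [smul_jacobian, jacobian_act, jacobian_ofC, det_fin_two_of, mulVec, dotProduct,
      Fin.sum_univ_two, of_apply, cons_val] at h_jac
    linear_combination h_jac
  have h00 := h_jac ![1, 0] ![1, 0]
  have h01 := h_jac ![1, 0] ![0, 1]
  have h11 := h_jac ![0, 1] ![0, 1]
  simp only [cons_val] at h00 h01 h11
  constructor <;> refine mul_left_cancel₀ h_ne ?_
  · linear_combination -h01
  · linear_combination -h11 - d' * h00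

theorem coeff_of_ofC_eq_act {d k d' k' α β γ δ w : F}
    (h : ofC d' k' = w • (ofC d k).act !![α, β; γ, δ]) :
    1 = w * (α * (α ^ 2 - 2 * k * α * γ + d * γ ^ 2) -
      γ * (k * α ^ 2 - 2 * d * α * γ + d * k * γ ^ 2)) ∧
    k' = w * (δ * (k * α ^ 2 - 2 * d * α * γ + d * k * γ ^ 2) -
      β * (α ^ 2 - 2 * k * α * γ + d * γ ^ 2)) := by
  have h_eval := congrArg (·.eval ![1, 0]) h
  simp only [smul_eval, eval_act] at h_eval
  have h0 := congrFun h_eval 0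
  have h1 := congrFun h_eval 1
  simp only [QuadPair.eval, ofC, adjugate_fin_two_of, mulVec, dotProduct, Fin.sum_univ_two,
    of_apply, cons_val, Pi.smul_apply, smul_eq_mul] at h0 h1
  constructor
  · linear_combination h1
  · linear_combination h0

theorem Rel.ofC_exists_param (h2 : (2 : F) ≠ 0) {d k d' k' : F} (hd : d ≠ 0) (hk : k ^ 2 ≠ d)
    (h : Rel (ofC d k) (ofC d' k')) :
    ∃ γ b, b ≠ 0 ∧ d' = b ^ 2 * d ∧ ((k ≠ 0 ∧ k' = b * d / k) ∨
      (d * k * γ ^ 3 + 3 * d * γ ^ 2 + 3 * k * γ + 1 ≠ 0 ∧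
        k' = b * (d ^ 2 * γ ^ 3 + 3 * d * k * γ ^ 2 + 3 * d * γ + k) /
          (d * k * γ ^ 3 + 3 * d * γ ^ 2 + 3 * k * γ + 1))) := by
  obtain ⟨g, w, hg, hw, h⟩ := h
  obtain ⟨α, β, γ, δ, rfl⟩ : ∃ α β γ δ, g = !![α, β; γ, δ] := ⟨_, _, _, _, eta_fin_two g⟩
  rw [det_fin_two_of] at hg
  obtain ⟨h_polar, h_disc⟩ := quadratic_form_of_ofC_eq_act h2 hk hg hw h
  obtain ⟨h_den, h_num⟩ := coeff_of_ofC_eq_act h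
  by_cases hδ : δ = 0
  · obtain ⟨hβ, hγ⟩ : β ≠ 0 ∧ γ ≠ 0 := by simpa [hδ] using hg
    obtain rfl : α = 0 := by simpa [hδ, hβ] using h_polar
    subst hδ
    have hk0 : k ≠ 0 := by
      rintro rfl
      simp at h_den
    refine ⟨0, β / (d * γ), by positivity, ?_, Or.inl ⟨hk0, ?_⟩⟩
    · field_simp
      linear_combination -h_disc
    · field_simp
      linear_combination k * γ * h_num - β * h_den
  · obtain ⟨τ, rfl⟩ : ∃ τ, β = -(d * δ * τ) := ⟨-(β / (d * δ)), by field_simp⟩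
    obtain rfl : γ = -(α * τ) := by
      refine mul_left_cancel₀ (mul_ne_zero hd hδ) ?_
      linear_combination -h_polar
    have hα : α ≠ 0 := by
      rintro rfl
      simp at hg
    have hτ : 1 - d * τ ^ 2 ≠ 0 := fun h0 ↦ hg (by linear_combination α * δ * h0)
    have h_den' : w * α ^ 3 * (d * k * τ ^ 3 + 3 * d * τ ^ 2 + 3 * k * τ + 1) = 1 := by
      linear_combination -h_den
    have hD := right_ne_zero_of_mul_eq_one h_den'
    refine ⟨τ, δ / α, div_ne_zero hδ hα, ?_, Or.inr ⟨hD, ?_⟩⟩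
    · field_simp
      refine mul_right_cancel₀ hτ ?_
      linear_combination h_disc
    · rw [eq_div_iff hD, div_mul_eq_mul_div, eq_div_iff hα]
      refine mul_left_cancel₀ (mul_ne_zero hw (pow_ne_zero 2 hα)) ?_
      linear_combination h_num + k' * h_den'

theorem rel_ofC_antidiagonal {d k b : F} (hd : d ≠ 0) (hk : k ≠ 0) (hb : b ≠ 0) :
    Rel (ofC d k) (ofC (b ^ 2 * d) (b * d / k)) := by
  refine ⟨!![0, b * d; 1, 0], -(d * k)⁻¹, by simpa using ⟨hb, hd⟩, by simpa using ⟨hk, hd⟩, ?_⟩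
  simp only [ofC, act, subst, comb, smul_def, adjugate_fin_two_of, of_apply, cons_val]
  ext <;> field_simp <;> ring

theorem rel_ofC_of_param {d k k' γ b : F} (hb : b ≠ 0) (hk' : k' ^ 2 ≠ b ^ 2 * d)
    (hD : d * k * γ ^ 3 + 3 * d * γ ^ 2 + 3 * k * γ + 1 ≠ 0)
    (h : k' = b * (d ^ 2 * γ ^ 3 + 3 * d * k * γ ^ 2 + 3 * d * γ + k) /
      (d * k * γ ^ 3 + 3 * d * γ ^ 2 + 3 * k * γ + 1)) :
    Rel (ofC d k) (ofC (b ^ 2 * d) k') := by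
  refine ⟨!![1, -(d * b * γ); -γ, b], (d * k * γ ^ 3 + 3 * d * γ ^ 2 + 3 * k * γ + 1)⁻¹, ?_,
    inv_ne_zero hD, ?_⟩
  · have hγ : 1 - d * γ ^ 2 ≠ 0 := by
      intro h0
      rw [eq_div_iff hD] at h
      have h_mul : k' * γ = b := by
        refine mul_right_cancel₀ hD ?_
        linear_combination γ * h - b * (d * γ ^ 2 + 1 + 2 * k * γ) * h0
      refine hk' ?_
      linear_combination k' ^ 2 * h0 + d * (k' * γ + b) * h_mul
    convert mul_ne_zero hb hγ using 1
    rw [det_fin_two_of]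
    ring
  · generalize h_eq : d * k * γ ^ 3 + 3 * d * γ ^ 2 + 3 * k * γ + 1 = D at *
    simp only [ofC, act, subst, comb, smul_def, adjugate_fin_two_of, of_apply, cons_val, h]
    ext <;> field_simp <;> first | ring1 | (rw [← h_eq]; ring1)

theorem Rel.map {E : Type*} [Field E] (i : F →+* E) {q q' : QuadPair F} (h : Rel q q') :
    Rel (q.map i) (q'.map i) := by
  obtain ⟨g, w, hg, hw, rfl⟩ := h
  refine ⟨g.map i, i w, ?_, by simpa using hw, ?_⟩
  · rw [← RingHom.mapMatrix_apply, ← RingHom.map_det]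
    simpa using hg
  · ext <;> simp [QuadPair.map, act, subst, comb, smul_def, adjugate_fin_two, map_ofNat i 2]

theorem Rel.hasMultipliers {q q' : QuadPair F} (hq : q.res ≠ 0) (h : Rel q q')
    {v : Fin 3 → Fin 2 → AlgebraicClosure F} {l : Fin 3 → AlgebraicClosure F}
    (hl : (q'.map (algebraMap F (AlgebraicClosure F))).HasFixedPoints v l) :
    HasMultipliers q.toRat (l 0) (l 1) (l 2) := by
  obtain ⟨w, hw⟩ := hl.exists_of_rel (h.map _).symm
  rw [HasMultipliers, toBar_toRat]
  exact hw.multipliers_toRat (res_map_ne_zero _ hq)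

theorem isConj_toBar_toRat_iff {q q' : QuadPair F} (hq : q.res ≠ 0) :
    IsConj (toBar q.toRat) (toBar q'.toRat) ↔
      Rel (q.map (algebraMap F (AlgebraicClosure F))) (q'.map (algebraMap F _)) := by
  rw [toBar_toRat, toBar_toRat, isConj_toRat_iff (res_map_ne_zero _ hq)]

end QuadPair

open QuadPair

theorem condB_two_mul_sub_one (h2 : (2 : F) ≠ 0) {k : F} (hk : k ≠ 0) (hk' : k ≠ -1 / 2) :
    CondB (2 * k - 1) (2 * k - 1) (1 / k) := by
  by_cases h1 : k = 1
  · subst h1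
    exact Or.inr ⟨by ring, by ring, by ring⟩
  have h_sub : k - 1 ≠ 0 := sub_ne_zero.2 h1
  have h_add : 2 * k + 1 ≠ 0 := fun h ↦ hk' (by rw [eq_div_iff h2]; linear_combination h)
  refine Or.inl ⟨rfl, fun h ↦ ?_, fun h ↦ ?_⟩
  · exact mul_ne_zero h2 h_sub (by linear_combination h)
  · rw [div_eq_iff hk] at h
    exact mul_ne_zero h_add h_sub (by linear_combination -h)

variable {K : Type*} [Field K] {ψ : RatFunc K}

theorem ofNat_algebraicClosure_ne_zero {n : ℕ} [n.AtLeastTwo] (hn : (OfNat.ofNat n : K) ≠ 0) :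
    (OfNat.ofNat n : AlgebraicClosure K) ≠ 0 := by
  rw [← map_ofNat (algebraMap K (AlgebraicClosure K))]
  simpa using hn

theorem algebraMap_ne_neg_half {k : K} (hk : k ≠ -1 / 2) :
    algebraMap K (AlgebraicClosure K) k ≠ -1 / 2 := by
  convert (algebraMap K (AlgebraicClosure K)).injective.ne hk
  simp [map_ofNat (algebraMap K (AlgebraicClosure K)) 2]

theorem exists_hasMultipliers_of_isConj_formA (hψ : ratDegree ψ = 2) {s t : K}
    (h : IsConj ψ (formA s t)) : ∃ l₁ l₂ l₃, HasMultipliers ψ l₁ l₂ l₃ ∧ CondA l₁ l₂ l₃ ∧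
      l₁ + l₂ + l₃ = algebraMap K _ s ∧ l₁ * l₂ + l₁ * l₃ + l₂ * l₃ = algebraMap K _ t := by
  obtain ⟨q, hq, rfl⟩ := exists_toRat_eq hψ
  rw [← toRat_ofA, isConj_toRat_iff hq] at h
  have hr := res_map_ne_zero (algebraMap K (AlgebraicClosure K)) (h.res_ne_zero hq)
  rw [map_ofA] at hr
  obtain ⟨v, l, hs, ht, hA, hl⟩ := exists_hasFixedPoints_ofA hr
  rw [← map_ofA] at hl
  exact ⟨_, _, _, h.hasMultipliers hq hl, hA, hs, ht⟩

theorem hasMultipliers_of_isConj_formB (hψ : ratDegree ψ = 2) {k b : K} (hk : k ≠ 0) (hb : b ≠ 0)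
    (h : IsConj ψ (formB k b)) : HasMultipliers ψ (2 * algebraMap K _ k - 1)
      (2 * algebraMap K _ k - 1) (1 / algebraMap K _ k) := by
  obtain ⟨q, hq, rfl⟩ := exists_toRat_eq hψ
  rw [← toRat_ofB, isConj_toRat_iff hq] at h
  have h_alg {x : K} (hx : x ≠ 0) : algebraMap K (AlgebraicClosure K) x ≠ 0 := by simpa using hx
  obtain ⟨v, hl⟩ := exists_hasFixedPoints_ofB (h_alg hk) (h_alg hb)
  rw [← map_ofB] at hl
  exact h.hasMultipliers hq hl

theorem hasMultipliers_of_isConj_formC (hψ : ratDegree ψ = 2) {d k : K}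
    (h : IsConj ψ (formC d k)) : HasMultipliers ψ (-2) (-2) (-2) := by
  obtain ⟨q, hq, rfl⟩ := exists_toRat_eq hψ
  rw [← toRat_ofC, isConj_toRat_iff hq] at h
  obtain ⟨v, hl⟩ := exists_hasFixedPoints_ofC (algebraMap K (AlgebraicClosure K) d)
    (algebraMap K _ k)
  rw [← map_ofC] at hl
  exact h.hasMultipliers hq hl

theorem inCaseA_of_isConj_formA (hψ : ratDegree ψ = 2) {s t : K} (h : IsConj ψ (formA s t)) :
    InCaseA ψ := by
  obtain ⟨l₁, l₂, l₃, hl, hA, -, -⟩ := exists_hasMultipliers_of_isConj_formA hψ h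
  exact ⟨l₁, l₂, l₃, hl, hA⟩

theorem inCaseB_of_isConj_formB (h2 : (2 : K) ≠ 0) (hψ : ratDegree ψ = 2) {k b : K} (hk : k ≠ 0)
    (hk' : k ≠ -1 / 2) (hb : b ≠ 0) (h : IsConj ψ (formB k b)) : InCaseB ψ :=
  ⟨_, _, _, hasMultipliers_of_isConj_formB hψ hk hb h, condB_two_mul_sub_one
    (ofNat_algebraicClosure_ne_zero h2) (by simpa using hk) (algebraMap_ne_neg_half hk')⟩

theorem inCaseC_of_isConj_formC (hψ : ratDegree ψ = 2) {d k : K} (h : IsConj ψ (formC d k)) :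
    InCaseC ψ :=
  ⟨_, _, _, hasMultipliers_of_isConj_formC hψ h, rfl, rfl, rfl⟩

theorem not_inCaseA_and_inCaseB : ¬(InCaseA ψ ∧ InCaseB ψ) := by
  rintro ⟨⟨l₁, l₂, l₃, hl, hA⟩, m₁, m₂, m₃, hm, hB⟩
  have hA' := hA.congr (hl.symm.trans hm)
  grind [CondA, CondB]

theorem not_inCaseA_and_inCaseC : ¬(InCaseA ψ ∧ InCaseC ψ) := by
  rintro ⟨⟨l₁, l₂, l₃, hl, hA⟩, m₁, m₂, m₃, hm, hC⟩
  have hA' := hA.congr (hl.symm.trans hm)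
  grind [CondA, CondC]

theorem not_inCaseB_and_inCaseC (h3 : (3 : K) ≠ 0) : ¬(InCaseB ψ ∧ InCaseC ψ) := by
  rintro ⟨⟨l₁, l₂, l₃, hl, hB⟩, m₁, m₂, m₃, hm, hC⟩
  obtain ⟨rfl, rfl, rfl⟩ := hC.congr (hm.symm.trans hl)
  obtain ⟨-, -, h⟩ | ⟨h, -, -⟩ := hB
  · exact h rfl
  · exact ofNat_algebraicClosure_ne_zero h3 (by linear_combination -h)

theorem exists_isConj_formA_or_formB_or_formC (h2 : (2 : K) ≠ 0) (hψ : ratDegree ψ = 2) :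
    (∃ s t, IsConj ψ (formA s t)) ∨
      (∃ k b, k ≠ 0 ∧ k ≠ -1 / 2 ∧ b ≠ 0 ∧ IsConj ψ (formB k b)) ∨
      ∃ d k, d ≠ 0 ∧ k ^ 2 ≠ d ∧ IsConj ψ (formC d k) := by
  obtain ⟨q, hq, rfl⟩ := exists_toRat_eq hψ
  simpa only [← toRat_ofA, ← toRat_ofB, ← toRat_ofC, isConj_toRat_iff hq] using
    rel_normal_form h2 hq

theorem inCaseA_or_inCaseB_or_inCaseC (h2 : (2 : K) ≠ 0) (hψ : ratDegree ψ = 2) :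
    InCaseA ψ ∨ InCaseB ψ ∨ InCaseC ψ := by
  obtain ⟨s, t, h⟩ | ⟨k, b, hk, hk', hb, h⟩ | ⟨d, k, -, -, h⟩ :=
    exists_isConj_formA_or_formB_or_formC h2 hψ
  exacts [Or.inl (inCaseA_of_isConj_formA hψ h),
    Or.inr (Or.inl (inCaseB_of_isConj_formB h2 hψ hk hk' hb h)),
    Or.inr (Or.inr (inCaseC_of_isConj_formC hψ h))]

theorem inCaseA_iff (h2 : (2 : K) ≠ 0) (hψ : ratDegree ψ = 2) :
    InCaseA ψ ↔ ∃ s t, IsConj ψ (formA s t) := by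
  refine ⟨fun hA ↦ ?_, fun ⟨s, t, h⟩ ↦ inCaseA_of_isConj_formA hψ h⟩
  obtain h | ⟨k, b, hk, hk', hb, h⟩ | ⟨d, k, -, -, h⟩ :=
    exists_isConj_formA_or_formB_or_formC h2 hψ
  · exact h
  · exact (not_inCaseA_and_inCaseB ⟨hA, inCaseB_of_isConj_formB h2 hψ hk hk' hb h⟩).elim
  · exact (not_inCaseA_and_inCaseC ⟨hA, inCaseC_of_isConj_formC hψ h⟩).elim

theorem inCaseB_iff (h2 : (2 : K) ≠ 0) (h3 : (3 : K) ≠ 0) (hψ : ratDegree ψ = 2) :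
    InCaseB ψ ↔ ∃ k b, k ≠ 0 ∧ k ≠ -1 / 2 ∧ b ≠ 0 ∧ IsConj ψ (formB k b) := by
  refine ⟨fun hB ↦ ?_, fun ⟨k, b, hk, hk', hb, h⟩ ↦ inCaseB_of_isConj_formB h2 hψ hk hk' hb h⟩
  obtain ⟨s, t, h⟩ | h | ⟨d, k, -, -, h⟩ := exists_isConj_formA_or_formB_or_formC h2 hψ
  · exact (not_inCaseA_and_inCaseB ⟨inCaseA_of_isConj_formA hψ h, hB⟩).elim
  · exact h
  · exact (not_inCaseB_and_inCaseC h3 ⟨hB, inCaseC_of_isConj_formC hψ h⟩).elim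

theorem inCaseC_iff (h2 : (2 : K) ≠ 0) (h3 : (3 : K) ≠ 0) (hψ : ratDegree ψ = 2) :
    InCaseC ψ ↔ ∃ d k, d ≠ 0 ∧ k ^ 2 ≠ d ∧ IsConj ψ (formC d k) := by
  refine ⟨fun hC ↦ ?_, fun ⟨d, k, _, _, h⟩ ↦ inCaseC_of_isConj_formC hψ h⟩
  obtain ⟨s, t, h⟩ | ⟨k, b, hk, hk', hb, h⟩ | h := exists_isConj_formA_or_formB_or_formC h2 hψ
  · exact (not_inCaseA_and_inCaseC ⟨inCaseA_of_isConj_formA hψ h, hC⟩).elim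
  · exact (not_inCaseB_and_inCaseC h3 ⟨inCaseB_of_isConj_formB h2 hψ hk hk' hb h, hC⟩).elim
  · exact h

section Multipliers

variable {l₁ l₂ l₃ : AlgebraicClosure K}

theorem HasMultipliers.exists_isConj_formA (h2 : (2 : K) ≠ 0) (hψ : ratDegree ψ = 2)
    (hl : HasMultipliers ψ l₁ l₂ l₃) (hA : CondA l₁ l₂ l₃) :
    ∃ s t, algebraMap K (AlgebraicClosure K) s = l₁ + l₂ + l₃ ∧
      algebraMap K (AlgebraicClosure K) t = l₁ * l₂ + l₁ * l₃ + l₂ * l₃ ∧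
      IsConj ψ (formA s t) := by
  obtain ⟨s, t, h⟩ := (inCaseA_iff h2 hψ).1 ⟨l₁, l₂, l₃, hl, hA⟩
  obtain ⟨m₁, m₂, m₃, hm, -, hs, ht⟩ := exists_hasMultipliers_of_isConj_formA hψ h
  obtain ⟨h_sum, h_prod⟩ := sum_prod_eq_of_multiset_eq (hm.symm.trans hl)
  exact ⟨s, t, hs.symm.trans h_sum, ht.symm.trans h_prod, h⟩

theorem HasMultipliers.exists_isConj_formB (h2 : (2 : K) ≠ 0) (h3 : (3 : K) ≠ 0)
    (hψ : ratDegree ψ = 2) (hl : HasMultipliers ψ l₁ l₂ l₃) (hB : CondB l₁ l₂ l₃) :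
    ∃ k b, k ≠ 0 ∧ k ≠ -1 / 2 ∧ b ≠ 0 ∧ algebraMap K (AlgebraicClosure K) k = (l₁ + 1) / 2 ∧
      IsConj ψ (formB k b) := by
  obtain ⟨k, b, hk, hk', hb, h⟩ := (inCaseB_iff h2 h3 hψ).1 ⟨l₁, l₂, l₃, hl, hB⟩
  obtain rfl : l₁ = l₂ := by grind [CondB]
  have h_mult := eq_of_pair_eq (hl.symm.trans (hasMultipliers_of_isConj_formB hψ hk hb h))
  refine ⟨k, b, hk, hk', hb, ?_, h⟩
  rw [eq_div_iff (ofNat_algebraicClosure_ne_zero h2)]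
  linear_combination -h_mult

end Multipliers

theorem formA_param_eq_of_isConj_toBar {s t s' t' : K} (hψ : ratDegree (formA s t) = 2)
    (h : IsConj (toBar (formA s t)) (toBar (formA s' t'))) : s = s' ∧ t = t' := by
  simp only [← toRat_ofA] at h hψ
  have hr := res_ne_zero_of_ratDegree hψ
  have hr' := res_map_ne_zero (algebraMap K (AlgebraicClosure K)) hr
  rw [map_ofA] at hr'
  rw [isConj_toBar_toRat_iff hr, map_ofA, map_ofA] at h
  simpa using h.ofA_inj hr'

theorem ratDegree_formB {k b : K} (hk : k ≠ 0) (hb : b ≠ 0) : ratDegree (formB k b) = 2 := by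
  rw [← toRat_ofB]
  exact ratDegree_toRat (res_ofB_ne_zero hk hb)

theorem ratDegree_formC (h2 : (2 : K) ≠ 0) {d k : K} (hd : d ≠ 0) (hk : k ^ 2 ≠ d) :
    ratDegree (formC d k) = 2 := by
  rw [← toRat_ofC]
  exact ratDegree_toRat (res_ofC_ne_zero h2 hd hk)

theorem isConj_toBar_formB_iff (h2 : (2 : K) ≠ 0) {k b k' b' : K} (hk : k ≠ 0) (hb : b ≠ 0)
    (hk' : k' ≠ 0) (hb' : b' ≠ 0) :
    IsConj (toBar (formB k b)) (toBar (formB k' b')) ↔ k = k' := by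
  have h_alg {x : K} (hx : x ≠ 0) : algebraMap K (AlgebraicClosure K) x ≠ 0 := by simpa using hx
  rw [← toRat_ofB, ← toRat_ofB, isConj_toBar_toRat_iff (res_ofB_ne_zero hk hb), map_ofB, map_ofB]
  constructor
  · intro h
    simpa using h.ofB_fst_eq (ofNat_algebraicClosure_ne_zero h2) (h_alg hk) (h_alg hb) (h_alg hk')
      (h_alg hb')
  · rintro rfl
    obtain ⟨c, hc⟩ := IsAlgClosed.exists_pow_nat_eq
      (algebraMap K (AlgebraicClosure K) b / algebraMap K _ b') two_pos
    have hc0 : c ^ 2 ≠ 0 := hc ▸ div_ne_zero (h_alg hb) (h_alg hb')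
    exact rel_ofB_of_div_eq_sq (h_alg hb') (by simpa using hc0) hc.symm

theorem isConj_formB_iff (h2 : (2 : K) ≠ 0) {k b k' b' : K} (hk : k ≠ 0) (hkh : k ≠ -1 / 2)
    (hb : b ≠ 0) (hk' : k' ≠ 0) (hb' : b' ≠ 0) :
    IsConj (formB k b) (formB k' b') ↔ k = k' ∧ ∃ c, c ≠ 0 ∧ b / b' = c ^ 2 := by
  have hr := res_ofB_ne_zero hk hb
  rw [← toRat_ofB, ← toRat_ofB, isConj_toRat_iff hr]
  constructor
  · intro h
    have h_bar := (isConj_toBar_toRat_iff hr).2 (h.map _)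
    rw [toRat_ofB, toRat_ofB, isConj_toBar_formB_iff h2 hk hb hk' hb'] at h_bar
    subst h_bar
    refine ⟨rfl, h.ofB_exists_div_eq_sq (fun h0 ↦ hkh ?_) hb'⟩
    rw [eq_div_iff h2]
    linear_combination h0
  · rintro ⟨rfl, c, hc, h⟩
    exact rel_ofB_of_div_eq_sq hb' hc h

theorem isConj_toBar_formC (h2 : (2 : K) ≠ 0) {d k d' k' : K} (hd : d ≠ 0) (hk : k ^ 2 ≠ d)
    (hd' : d' ≠ 0) (hk' : k' ^ 2 ≠ d') : IsConj (toBar (formC d k)) (toBar (formC d' k')) := by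
  have h_inv_sq {d k : K} (hd : d ≠ 0) (hk : k ^ 2 ≠ d) :
      Rel ((ofC d k).map (algebraMap K (AlgebraicClosure K))) ⟨0, 0, 1, 1, 0, 0⟩ := by
    rw [map_ofC]
    refine rel_ofC_inv_sq (ofNat_algebraicClosure_ne_zero h2) (by simpa using hd) ?_
    rw [← map_pow]
    exact (algebraMap K (AlgebraicClosure K)).injective.ne hk
  rw [← toRat_ofC, ← toRat_ofC, isConj_toBar_toRat_iff (res_ofC_ne_zero h2 hd hk)]
  exact (h_inv_sq hd hk).trans (h_inv_sq hd' hk').symm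

theorem isConj_formC_iff (h2 : (2 : K) ≠ 0) {d k d' k' : K} (hd : d ≠ 0) (hk : k ^ 2 ≠ d)
    (hk' : k' ^ 2 ≠ d') : IsConj (formC d k) (formC d' k') ↔
      ∃ γ b, b ≠ 0 ∧ d' = b ^ 2 * d ∧ ((k ≠ 0 ∧ k' = b * d / k) ∨
        (d * k * γ ^ 3 + 3 * d * γ ^ 2 + 3 * k * γ + 1 ≠ 0 ∧
          k' = b * (d ^ 2 * γ ^ 3 + 3 * d * k * γ ^ 2 + 3 * d * γ + k) /
            (d * k * γ ^ 3 + 3 * d * γ ^ 2 + 3 * k * γ + 1))) := by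
  rw [← toRat_ofC, ← toRat_ofC, isConj_toRat_iff (res_ofC_ne_zero h2 hd hk)]
  refine ⟨fun h ↦ h.ofC_exists_param h2 hd hk, ?_⟩
  rintro ⟨γ, b, hb, rfl, ⟨hk0, rfl⟩ | ⟨hD, h⟩⟩
  · exact rel_ofC_antidiagonal hd hk0 hb
  · exact rel_ofC_of_param hb hk' hD h

end QuadraticMaps

end

theorem theorem1 (K : Type*) [Field K] (hK2 : ringChar K ≠ 2) (hK3 : ringChar K ≠ 3) :
    -- (a)
    ((∀ (ψ : RatFunc K) (l₁ l₂ l₃ : AlgebraicClosure K),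
        QuadraticMaps.ratDegree ψ = 2 → QuadraticMaps.HasMultipliers ψ l₁ l₂ l₃ →
        QuadraticMaps.CondA l₁ l₂ l₃ →
        ∃ s t : K, algebraMap K (AlgebraicClosure K) s = l₁ + l₂ + l₃ ∧
          algebraMap K (AlgebraicClosure K) t = l₁ * l₂ + l₁ * l₃ + l₂ * l₃ ∧
          QuadraticMaps.IsConj ψ (QuadraticMaps.formA s t)) ∧
      (∀ s t s' t' : K,
        QuadraticMaps.ratDegree (QuadraticMaps.formA s t) = 2 →
        QuadraticMaps.ratDegree (QuadraticMaps.formA s' t') = 2 →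
        QuadraticMaps.IsConj (QuadraticMaps.toBar (QuadraticMaps.formA s t))
          (QuadraticMaps.toBar (QuadraticMaps.formA s' t')) →
        s = s' ∧ t = t')) ∧
    -- (b)
    ((∀ (ψ : RatFunc K) (l₁ l₂ l₃ : AlgebraicClosure K),
        QuadraticMaps.ratDegree ψ = 2 → QuadraticMaps.HasMultipliers ψ l₁ l₂ l₃ →
        QuadraticMaps.CondB l₁ l₂ l₃ →
        ∃ k b : K, k ≠ 0 ∧ k ≠ -1 / 2 ∧ b ≠ 0 ∧
          algebraMap K (AlgebraicClosure K) k = (l₁ + 1) / 2 ∧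
          QuadraticMaps.IsConj ψ (QuadraticMaps.formB k b)) ∧
      (∀ k b k' b' : K, k ≠ 0 → k ≠ -1 / 2 → b ≠ 0 → k' ≠ 0 → k' ≠ -1 / 2 → b' ≠ 0 →
        (QuadraticMaps.IsConj (QuadraticMaps.toBar (QuadraticMaps.formB k b))
            (QuadraticMaps.toBar (QuadraticMaps.formB k' b')) ↔ k = k') ∧
        (QuadraticMaps.IsConj (QuadraticMaps.formB k b) (QuadraticMaps.formB k' b') ↔
          k = k' ∧ ∃ c : K, c ≠ 0 ∧ b / b' = c ^ 2))) ∧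
    -- (c)
    ((∀ (ψ : RatFunc K) (l₁ l₂ l₃ : AlgebraicClosure K),
        QuadraticMaps.ratDegree ψ = 2 → QuadraticMaps.HasMultipliers ψ l₁ l₂ l₃ →
        QuadraticMaps.CondC l₁ l₂ l₃ →
        ∃ d k : K, d ≠ 0 ∧ k ^ 2 ≠ d ∧ QuadraticMaps.IsConj ψ (QuadraticMaps.formC d k)) ∧
      (∀ d k d' k' : K, d ≠ 0 → k ^ 2 ≠ d → d' ≠ 0 → k' ^ 2 ≠ d' →
        QuadraticMaps.IsConj (QuadraticMaps.toBar (QuadraticMaps.formC d k))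
            (QuadraticMaps.toBar (QuadraticMaps.formC d' k')) ∧
        (QuadraticMaps.IsConj (QuadraticMaps.formC d k) (QuadraticMaps.formC d' k') ↔
          ∃ γ b : K, b ≠ 0 ∧ d' = b ^ 2 * d ∧
            ((k ≠ 0 ∧ k' = b * d / k) ∨
              (d * k * γ ^ 3 + 3 * d * γ ^ 2 + 3 * k * γ + 1 ≠ 0 ∧
                k' = b * (d ^ 2 * γ ^ 3 + 3 * d * k * γ ^ 2 + 3 * d * γ + k) /
                  (d * k * γ ^ 3 + 3 * d * γ ^ 2 + 3 * k * γ + 1)))))) ∧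
    -- every quadratic map is in exactly one case, and the three lists of normal forms are complete
    (∀ ψ : RatFunc K, QuadraticMaps.ratDegree ψ = 2 →
      (QuadraticMaps.InCaseA ψ ∨ QuadraticMaps.InCaseB ψ ∨ QuadraticMaps.InCaseC ψ) ∧
      ¬ (QuadraticMaps.InCaseA ψ ∧ QuadraticMaps.InCaseB ψ) ∧
      ¬ (QuadraticMaps.InCaseA ψ ∧ QuadraticMaps.InCaseC ψ) ∧
      ¬ (QuadraticMaps.InCaseB ψ ∧ QuadraticMaps.InCaseC ψ) ∧
      (QuadraticMaps.InCaseA ψ ↔ ∃ s t : K, QuadraticMaps.IsConj ψ (QuadraticMaps.formA s t)) ∧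
      (QuadraticMaps.InCaseB ψ ↔ ∃ k b : K, k ≠ 0 ∧ k ≠ -1 / 2 ∧ b ≠ 0 ∧
        QuadraticMaps.IsConj ψ (QuadraticMaps.formB k b)) ∧
      (QuadraticMaps.InCaseC ψ ↔ ∃ d k : K, d ≠ 0 ∧ k ^ 2 ≠ d ∧
        QuadraticMaps.IsConj ψ (QuadraticMaps.formC d k))) ∧
    -- the normal forms of (b) and (c) are quadratic
    (∀ k b : K, k ≠ 0 → b ≠ 0 → QuadraticMaps.ratDegree (QuadraticMaps.formB k b) = 2) ∧
    (∀ d k : K, d ≠ 0 → k ^ 2 ≠ d → QuadraticMaps.ratDegree (QuadraticMaps.formC d k) = 2) := by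
  have h2 : (2 : K) ≠ 0 := CharP.cast_ne_zero_of_ne_of_prime K Nat.prime_two hK2
  have h3 : (3 : K) ≠ 0 := CharP.cast_ne_zero_of_ne_of_prime K Nat.prime_three hK3
  refine ⟨⟨?_, ?_⟩, ⟨?_, ?_⟩, ⟨?_, ?_⟩, ?_, ?_, ?_⟩
  · exact fun ψ l₁ l₂ l₃ hψ hl hA ↦ hl.exists_isConj_formA h2 hψ hA
  · exact fun s t s' t' hψ _ h ↦ QuadraticMaps.formA_param_eq_of_isConj_toBar hψ h
  · exact fun ψ l₁ l₂ l₃ hψ hl hB ↦ hl.exists_isConj_formB h2 h3 hψ hB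
  · exact fun k b k' b' hk hk_half hb hk' _ hb' ↦
      ⟨QuadraticMaps.isConj_toBar_formB_iff h2 hk hb hk' hb',
        QuadraticMaps.isConj_formB_iff h2 hk hk_half hb hk' hb'⟩
  · exact fun ψ l₁ l₂ l₃ hψ hl hC ↦ (QuadraticMaps.inCaseC_iff h2 h3 hψ).1 ⟨_, _, _, hl, hC⟩
  · exact fun d k d' k' hd hk hd' hk' ↦
      ⟨QuadraticMaps.isConj_toBar_formC h2 hd hk hd' hk',
        QuadraticMaps.isConj_formC_iff h2 hd hk hk'⟩
  · exact fun ψ hψ ↦ ⟨QuadraticMaps.inCaseA_or_inCaseB_or_inCaseC h2 hψ,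
      QuadraticMaps.not_inCaseA_and_inCaseB, QuadraticMaps.not_inCaseA_and_inCaseC,
      QuadraticMaps.not_inCaseB_and_inCaseC h3, QuadraticMaps.inCaseA_iff h2 hψ,
      QuadraticMaps.inCaseB_iff h2 h3 hψ, QuadraticMaps.inCaseC_iff h2 h3 hψ⟩
  · exact fun k b hk hb ↦ QuadraticMaps.ratDegree_formB hk hb
  · exact fun d k hd hk ↦ QuadraticMaps.ratDegree_formC h2 hd hk
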